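/- Let $m\ge 1$, let $a_1,\dots,a_m,b_1,\dots,b_m$ be positive real numbers, put $Q_i(z,w)=1-a_iz-b_iw$ and $Q=\prod_{i=1}^m Q_i$, and let $\mathcal V_i=\{Q_i=0\}\subset\mathbb C^2$, $\mathcal V=\{Q=0\}=\bigcup_i\mathcal V_i$. Assume that the lines $\mathcal V_i$ are in general position: any two of them meet in exactly one point (equivalently $\Delta_{ij}=a_ib_j-a_jb_i\ne0$ for $i\neq j$), and no three of them have a common point. Let $P\in\mathbb C[z,w]$ be a polynomial without non-constant common factor with $Q$, and let $f(x,y)$ be the Taylor coefficients at the origin of $$F(z,w)=\frac{P(z,w)}{Q(z,w)}=\sum_{x,y\ge0}f(x,y)z^xw^y .$$ Let $M=\{(z,w)\in\mathbb R^2: z>0,\ w>0,\ Q_i(z,w)>0,\ i=1,\dots,m\}$ and assume that $P\ne0$ at every vertex of the polygon $M$ that does not lie on a coordinate axis. For $(p,q)\in\mathbb R_+^2\setminus\{(0,0)\}$ (where $\mathbb R_+=[0,\infty)$) let $(z_i,w_i)=\left(\frac{1}{a_i}\frac{p}{p+q},\frac1{b_i}\frac{q}{p+q}\right)$ be the solution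 of $Q_i=qz\,\partial_zQ_i-pw\,\partial_wQ_i=0$; for $i\neq j$ let $(z_{ij},w_{ij})$ be the solution of $Q_i=Q_j=0$. Define the cones $$K_i=\{(p,q):\ z^pw^q \text{ has its maximum over } \overline M \text{ and its maximum over } \mathcal V_i\cap\mathbb R_+^2 \text{ at } (z_i,w_i)\},$$ $$\Omega_{ij}=\{(p,q):\ z^pw^q \text{ has its maximum over } \overline M \text{ at } (z_{ij},w_{ij})\},$$ where attaining the maximum over a set includes belonging to that set. Then for almost every $(p,q)\in\mathbb Z_+^2$ (that is, for all $(p,q)\in\mathbb Z^2_+$ outside a finite union of rays starting at the origin) the point $(p,q)$ lies in the interior of some $K_i$ or of some $\Omega_{ij}$, $i\ne j$, and the following holds. Put $(\hat z,\hat w)=(z_i,w_i)$ if $(p,q)\in\operatorname{Int}K_i$ and $(\hat z,\hat w)=(z_{ij},w_{ij})$ if $(p,q)\in\operatorname{Int}\Omega_{ij}$ (for every such choice of indices). Then $\hat z,\hat w>0$, $(\hat z,\hat w)\in\mathcal V$, $f(kp,kq)\ne0$ for all sufficiently large $k$, and $$\lim_{k\to\infty}\left(\frac{f(kp+1,kq)}{f(kp,kq)},\frac{f(kp,kq+1)}{f(kp,kq)}\right)=\left(\frac1{\hat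 z},\frac1{\hat w}\right).$$ -/

import Mathlib

open Set Filter Topology

noncomputable section

namespace HornVector

/-- The linear polynomial `1 - α z - β w` in `ℂ[z, w]`; `z` is variable `0` and `w` is variable `1`. -/
def linearFactor (α β : ℝ) : MvPolynomial (Fin 2) ℂ :=
  1 - MvPolynomial.C (α : ℂ) * MvPolynomial.X 0 - MvPolynomial.C (β : ℂ) * MvPolynomial.X 1

/-- The denominator `Q = ∏ᵢ Qᵢ = ∏ᵢ (1 - aᵢ z - bᵢ w)`. -/
def denominator {m : ℕ} (a b : Fin m → ℝ) : MvPolynomial (Fin 2) ℂ :=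
  ∏ i, linearFactor (a i) (b i)

/-- The complex line `𝒱ᵢ = {Qᵢ = 0}` in `ℂ²`. -/
def line {m : ℕ} (a b : Fin m → ℝ) (i : Fin m) : Set (ℂ × ℂ) :=
  {v | MvPolynomial.eval ![v.1, v.2] (linearFactor (a i) (b i)) = 0}

/-- The singular set `𝒱 = {Q = 0}` in `ℂ²`. -/
def singularSet {m : ℕ} (a b : Fin m → ℝ) : Set (ℂ × ℂ) :=
  {v | MvPolynomial.eval ![v.1, v.2] (denominator a b) = 0}

/-- General position: any two of the lines meet in exactly one point, and no three of them
have a common point. -/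
def GeneralPosition {m : ℕ} (a b : Fin m → ℝ) : Prop :=
  (∀ i j, i ≠ j → ∃ v, line a b i ∩ line a b j = {v}) ∧
    ∀ i j l, i ≠ j → j ≠ l → i ≠ l → line a b i ∩ line a b j ∩ line a b l = ∅

/-- The power series of the rational function `P / Q` at the origin, `Q` having a nonzero constant
term. -/
def expansion (P Q : MvPolynomial (Fin 2) ℂ) : MvPowerSeries (Fin 2) ℂ :=
  (P : MvPowerSeries (Fin 2) ℂ) * (Q : MvPowerSeries (Fin 2) ℂ)⁻¹

/-- The Taylor coefficient `f(x, y)` of `z ^ x * w ^ y` in `P / Q`. -/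
def taylorCoeff (P Q : MvPolynomial (Fin 2) ℂ) (x y : ℕ) : ℂ :=
  MvPowerSeries.coeff (Finsupp.single 0 x + Finsupp.single 1 y) (expansion P Q)

/-- The Horn vector `(f(x+1,y)/f(x,y), f(x,y+1)/f(x,y))` of a double sequence. -/
def hornVector (f : ℕ → ℕ → ℂ) (x y : ℕ) : ℂ × ℂ :=
  (f (x + 1) y / f x y, f x (y + 1) / f x y)

/-- The (open) polygon `M`: `z > 0`, `w > 0` and `Qᵢ(z, w) > 0` for all `i`. -/
def polygon {m : ℕ} (a b : Fin m → ℝ) : Set (ℝ × ℝ) :=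
  {v | 0 < v.1 ∧ 0 < v.2 ∧ ∀ i, 0 < 1 - a i * v.1 - b i * v.2}

/-- The vertices of `M`: the extreme points of the closed polygon. -/
def vertices {m : ℕ} (a b : Fin m → ℝ) : Set (ℝ × ℝ) :=
  (closure (polygon a b)).extremePoints ℝ

/-- The part of the line `𝒱ᵢ` lying in the closed real quadrant `ℝ²₊`. -/
def linePos {m : ℕ} (a b : Fin m → ℝ) (i : Fin m) : Set (ℝ × ℝ) :=
  {v | 0 ≤ v.1 ∧ 0 ≤ v.2 ∧ ((v.1 : ℂ), (v.2 : ℂ)) ∈ line a b i}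

/-- `v ∈ S` and the maximum over `S` of `z ^ p * w ^ q` is attained at `v`. -/
def MaxAttainedAt (S : Set (ℝ × ℝ)) (p q : ℝ) (v : ℝ × ℝ) : Prop :=
  v ∈ S ∧ ∀ u ∈ S, u.1 ^ p * u.2 ^ q ≤ v.1 ^ p * v.2 ^ q

/-- The point `(zᵢ, wᵢ)`, solution of `Qᵢ = q z ∂Qᵢ/∂z - p w ∂Qᵢ/∂w = 0`
(see `smoothPoint_iff`). -/
def smoothPoint {m : ℕ} (a b : Fin m → ℝ) (i : Fin m) (p q : ℝ) : ℝ × ℝ :=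
  (p / (p + q) / a i, q / (p + q) / b i)

/-- The determinant `Δᵢⱼ = aᵢ bⱼ - aⱼ bᵢ`. -/
def crossDet {m : ℕ} (a b : Fin m → ℝ) (i j : Fin m) : ℝ :=
  a i * b j - a j * b i

/-- The point `(zᵢⱼ, wᵢⱼ)`, solution of `Qᵢ = Qⱼ = 0` (see `crossPoint_iff`). -/
def crossPoint {m : ℕ} (a b : Fin m → ℝ) (i j : Fin m) : ℝ × ℝ :=
  ((b j - b i) / crossDet a b i j, (a i - a j) / crossDet a b i j)

/-- The cone `Kᵢ ⊆ ℝ²₊` of all `(p, q)` for which `z ^ p * w ^ q` has the same maximum on the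
polygon `M` (with its boundary) and on the line `𝒱ᵢ`, attained at `(zᵢ, wᵢ)`. -/
def coneK {m : ℕ} (a b : Fin m → ℝ) (i : Fin m) : Set (ℝ × ℝ) :=
  {d | 0 ≤ d.1 ∧ 0 ≤ d.2 ∧
    MaxAttainedAt (closure (polygon a b)) d.1 d.2 (smoothPoint a b i d.1 d.2) ∧
    MaxAttainedAt (linePos a b i) d.1 d.2 (smoothPoint a b i d.1 d.2)}

/-- The cone `Ωᵢⱼ ⊆ ℝ²₊` of all `(p, q)` for which the maximum of `z ^ p * w ^ q` on the polygon
`M` (with its boundary) is attained at `(zᵢⱼ, wᵢⱼ)`. -/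
def coneΩ {m : ℕ} (a b : Fin m → ℝ) (i j : Fin m) : Set (ℝ × ℝ) :=
  {d | 0 ≤ d.1 ∧ 0 ≤ d.2 ∧
    MaxAttainedAt (closure (polygon a b)) d.1 d.2 (crossPoint a b i j)}

/-- `v` is the point `(ẑ, ŵ)` attached to the direction `(p, q)`: it is `(zᵢ, wᵢ)` if
`(p, q) ∈ Int Kᵢ`, and `(zᵢⱼ, wᵢⱼ)` if `(p, q) ∈ Int Ωᵢⱼ`. -/
def IsContributingPoint {m : ℕ} (a b : Fin m → ℝ) (p q : ℝ) (v : ℝ × ℝ) : Prop :=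
  (∃ i, (p, q) ∈ interior (coneK a b i) ∧ v = smoothPoint a b i p q) ∨
    ∃ i j, i ≠ j ∧ (p, q) ∈ interior (coneΩ a b i j) ∧ v = crossPoint a b i j

/-- `φ` holds for almost all `(p, q) ∈ ℤ²₊`: for all of them outside a finite union of rays
starting at the origin. -/
def ForAlmostAllDirections (φ : ℕ → ℕ → Prop) : Prop :=
  ∃ R : Finset (ℝ × ℝ), ∀ p q : ℕ,
    (∀ r ∈ R, ∀ t : ℝ, 0 ≤ t → ((p : ℝ), (q : ℝ)) ≠ t • r) → φ p q

theorem mem_line {m : ℕ} (a b : Fin m → ℝ) (i : Fin m) (v : ℂ × ℂ) :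
    v ∈ line a b i ↔ 1 - (a i : ℂ) * v.1 - (b i : ℂ) * v.2 = 0 := by
  simp [line, linearFactor]

theorem mem_singularSet {m : ℕ} (a b : Fin m → ℝ) (v : ℂ × ℂ) :
    v ∈ singularSet a b ↔ ∃ i, v ∈ line a b i := by
  simp [singularSet, line, denominator, Finset.prod_eq_zero_iff]

theorem expansion_mul_denominator {m : ℕ} (a b : Fin m → ℝ) (P : MvPolynomial (Fin 2) ℂ) :
    expansion P (denominator a b) * (denominator a b : MvPowerSeries (Fin 2) ℂ) = P := by
  have h : MvPowerSeries.constantCoeff (denominator a b : MvPowerSeries (Fin 2) ℂ) ≠ 0 := by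
    have h1 : MvPolynomial.constantCoeff (denominator a b) = 1 := by
      simp [denominator, linearFactor]
    rw [← MvPowerSeries.coeff_zero_eq_constantCoeff_apply, MvPolynomial.coeff_coe,
      ← MvPolynomial.constantCoeff_eq, h1]
    exact one_ne_zero
  rw [expansion, mul_assoc, MvPowerSeries.inv_mul_cancel _ h, mul_one]

theorem smoothPoint_iff {m : ℕ} (a b : Fin m → ℝ) (i : Fin m) (ha : 0 < a i) (hb : 0 < b i)
    {p q : ℝ} (hpq : 0 < p + q) (v : ℝ × ℝ) :
    v = smoothPoint a b i p q ↔
      1 - a i * v.1 - b i * v.2 = 0 ∧ q * v.1 * (-a i) - p * v.2 * (-b i) = 0 := by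
  obtain ⟨z, w⟩ := v
  simp only [smoothPoint, Prod.mk.injEq]
  constructor
  · rintro ⟨rfl, rfl⟩
    constructor <;> · field_simp; ring
  · rintro ⟨h1, h2⟩
    constructor
    · field_simp
      linear_combination (-p) * h1 - h2
    · field_simp
      linear_combination (-q) * h1 + h2

theorem crossPoint_iff {m : ℕ} (a b : Fin m → ℝ) (i j : Fin m) (h : crossDet a b i j ≠ 0)
    (v : ℝ × ℝ) :
    v = crossPoint a b i j ↔
      1 - a i * v.1 - b i * v.2 = 0 ∧ 1 - a j * v.1 - b j * v.2 = 0 := by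
  obtain ⟨z, w⟩ := v
  simp only [crossPoint, Prod.mk.injEq, eq_div_iff h]
  constructor
  · rintro ⟨h1, h2⟩
    constructor <;>
    · apply mul_left_cancel₀ h
      simp only [crossDet] at *
      first
        | linear_combination (-a i) * h1 - b i * h2
        | linear_combination (-a j) * h1 - b j * h2
  · rintro ⟨h1, h2⟩
    simp only [crossDet]
    constructor
    · linear_combination (-b j) * h1 + b i * h2
    · linear_combination a j * h1 - a i * h2

end HornVector

end

/-! Fix a direction `(p, q)`, let `v = (z, w)` be its contributing point and normalise the
coefficients of `P / Q` to `f(x, y) z ^ x w ^ y`. If, after division by a common scale, these have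
the same nonzero limit along `(kp + ε, kq + δ)` for all fixed `ε`, `δ`, then the Horn vector tends
to `(1 / z, 1 / w)` (`hornVector_of_tendsto`).

Write `P / Q = G * U`, where `U` is the inverse of the one or two linear factors vanishing at `v`
and `G` is `P` over the other factors, so that `G` converges absolutely at `v`. The normalised
coefficients of `U` have a probabilistic meaning. For one factor they are the binomial probabilities
of `x` successes in `x + y` trials with success probability `a i * z = p / (p + q)`, so the
direction follows the mean, where these probabilities vary slowly. For two factors, partial
fractions turn them into a difference of two binomial distribution functions divided by a constant;
if `p / (p + q)` lies strictly between the success probabilities, Chebyshev's inequality sends one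
function to `1` and the other to `0`. In both cases dominated convergence in the convolution
(`tendsto_termAt_mul_div`) gives `G(v)` times the behaviour of `U`, and `G(v) ≠ 0` because `P(v) ≠
0`.

It remains to locate `v`. First-order conditions (`MaxAttainedAt.first_order`) and weighted AM-GM
(`rpow_mul_rpow_le`) describe the maximisers of `z ^ p w ^ q` on the polygon. The directions to
discard are the two axes, those whose smooth point lies on a second line, and those where `P`
vanishes at a smooth point. There are finitely many (`finite_exceptionalRatios`), since coprimality
makes the restriction of `P` to each line a nonzero polynomial. -/

namespace HornVector

/-! ### Exponents and coefficient shifts. -/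

/-- The exponent of `z ^ x * w ^ y`. -/
noncomputable abbrev expo (x y : ℕ) : Fin 2 →₀ ℕ := Finsupp.single 0 x + Finsupp.single 1 y

theorem expo_apply_zero (x y : ℕ) : expo x y 0 = x := by simp [expo]

theorem expo_apply_one (x y : ℕ) : expo x y 1 = y := by simp [expo]

theorem expo_self (n : Fin 2 →₀ ℕ) : expo (n 0) (n 1) = n := by
  ext i
  fin_cases i <;> simp [expo]

/-- The equivalence between pairs of natural numbers and exponents. -/
noncomputable def expoEquiv : ℕ × ℕ ≃ (Fin 2 →₀ ℕ) where
  toFun t := expo t.1 t.2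
  invFun n := (n 0, n 1)
  left_inv t := by simp [expo_apply_zero, expo_apply_one]
  right_inv n := expo_self n

theorem expo_sub (x y x' y' : ℕ) : expo x y - expo x' y' = expo (x - x') (y - y') := by
  ext i
  fin_cases i <;> simp [expo]

theorem expo_le_iff (n : Fin 2 →₀ ℕ) (x y : ℕ) : n ≤ expo x y ↔ n 0 ≤ x ∧ n 1 ≤ y := by
  rw [Finsupp.le_def]
  simp [Fin.forall_fin_two, expo]

section coefficients

variable (φ : MvPowerSeries (Fin 2) ℂ)

theorem coeff_expo_succ_X_zero_mul (x y : ℕ) :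
    MvPowerSeries.coeff (expo (x + 1) y) (MvPowerSeries.X 0 * φ) =
      MvPowerSeries.coeff (expo x y) φ := by
  have h : expo (x + 1) y = Finsupp.single 0 1 + expo x y := by
    ext i
    fin_cases i <;> simp [expo, add_comm]
  rw [h, MvPowerSeries.X, MvPowerSeries.coeff_add_monomial_mul, one_mul]

theorem coeff_expo_zero_X_zero_mul (y : ℕ) :
    MvPowerSeries.coeff (expo 0 y) (MvPowerSeries.X 0 * φ) = 0 := by
  rw [MvPowerSeries.X, MvPowerSeries.coeff_monomial_mul, if_neg]
  intro h
  have := h 0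
  simp [expo] at this

theorem coeff_expo_succ_X_one_mul (x y : ℕ) :
    MvPowerSeries.coeff (expo x (y + 1)) (MvPowerSeries.X 1 * φ) =
      MvPowerSeries.coeff (expo x y) φ := by
  have h : expo x (y + 1) = Finsupp.single 1 1 + expo x y := by
    ext i
    fin_cases i <;> simp [expo, add_comm]
  rw [h, MvPowerSeries.X, MvPowerSeries.coeff_add_monomial_mul, one_mul]

theorem coeff_expo_zero_X_one_mul (x : ℕ) :
    MvPowerSeries.coeff (expo x 0) (MvPowerSeries.X 1 * φ) = 0 := by
  rw [MvPowerSeries.X, MvPowerSeries.coeff_monomial_mul, if_neg]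
  intro h
  have := h 1
  simp [expo] at this

end coefficients

/-! ### Weighted terms and absolute convergence. -/

/-- The weight `s ^ n₀ * t ^ n₁` of an exponent at `v = (s, t)`. -/
def monoWt (v : ℝ × ℝ) (n : Fin 2 →₀ ℕ) : ℝ := v.1 ^ n 0 * v.2 ^ n 1

theorem monoWt_add (v : ℝ × ℝ) (n k : Fin 2 →₀ ℕ) :
    monoWt v (n + k) = monoWt v n * monoWt v k := by
  simp only [monoWt, Finsupp.add_apply, pow_add]
  ring

/-- The term of the power series `φ` with exponent `n`, evaluated at `v`. -/
noncomputable def termAt (φ : MvPowerSeries (Fin 2) ℂ) (v : ℝ × ℝ) (n : Fin 2 →₀ ℕ) : ℂ :=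
  MvPowerSeries.coeff n φ * (monoWt v n : ℂ)

/-- Absolute convergence of the power series `φ` at `v`. -/
def AbsConv (φ : MvPowerSeries (Fin 2) ℂ) (v : ℝ × ℝ) : Prop :=
  Summable fun n => ‖termAt φ v n‖

theorem termAt_mul (φ ψ : MvPowerSeries (Fin 2) ℂ) (v : ℝ × ℝ) (n : Fin 2 →₀ ℕ) :
    termAt (φ * ψ) v n =
      ∑ t ∈ Finset.HasAntidiagonal.antidiagonal n, termAt φ v t.1 * termAt ψ v t.2 := by
  classical
  rw [termAt, MvPowerSeries.coeff_mul, Finset.sum_mul]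
  refine Finset.sum_congr rfl fun t ht => ?_
  rw [← Finset.HasAntidiagonal.mem_antidiagonal.mp ht, monoWt_add, termAt, termAt]
  push_cast
  ring

theorem AbsConv.mul {φ ψ : MvPowerSeries (Fin 2) ℂ} {v : ℝ × ℝ} (hφ : AbsConv φ v)
    (hψ : AbsConv ψ v) : AbsConv (φ * ψ) v := by
  have h := summable_sum_mul_antidiagonal_of_summable_mul
    (Summable.mul_of_nonneg hφ hψ (fun _ => norm_nonneg _) (fun _ => norm_nonneg _))
  refine Summable.of_nonneg_of_le (fun _ => norm_nonneg _) (fun n => ?_) h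
  rw [termAt_mul]
  exact (norm_sum_le _ _).trans_eq (by simp)

theorem tsum_termAt_mul {φ ψ : MvPowerSeries (Fin 2) ℂ} {v : ℝ × ℝ} (hφ : AbsConv φ v)
    (hψ : AbsConv ψ v) :
    ∑' n, termAt (φ * ψ) v n = (∑' n, termAt φ v n) * ∑' n, termAt ψ v n := by
  have h1 := Summable.of_norm hφ
  have h2 := Summable.of_norm hψ
  rw [h1.tsum_mul_tsum_eq_tsum_sum_antidiagonal h2 (summable_mul_of_summable_norm hφ hψ)]
  exact tsum_congr fun n => termAt_mul φ ψ v n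

theorem AbsConv.prod {ι : Type*} (s : Finset ι) (φ : ι → MvPowerSeries (Fin 2) ℂ) {v : ℝ × ℝ}
    (h : ∀ i ∈ s, AbsConv (φ i) v) (h1 : AbsConv 1 v) : AbsConv (∏ i ∈ s, φ i) v :=
  Finset.prod_induction φ (fun ψ => AbsConv ψ v) (fun _ _ => AbsConv.mul) h1 h

section polynomials

variable (P : MvPolynomial (Fin 2) ℂ) (v : ℝ × ℝ)

theorem termAt_coe_eq_zero {n : Fin 2 →₀ ℕ} (hn : n ∉ P.support) :
    termAt (P : MvPowerSeries (Fin 2) ℂ) v n = 0 := by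
  rw [termAt, MvPolynomial.coeff_coe, MvPolynomial.notMem_support_iff.mp hn, zero_mul]

theorem absConv_coe : AbsConv (P : MvPowerSeries (Fin 2) ℂ) v :=
  summable_of_ne_finset_zero (s := P.support) fun n hn => by
    rw [termAt_coe_eq_zero P v hn, norm_zero]

theorem tsum_termAt_coe :
    ∑' n, termAt (P : MvPowerSeries (Fin 2) ℂ) v n =
      MvPolynomial.eval ![(v.1 : ℂ), (v.2 : ℂ)] P := by
  rw [tsum_eq_sum (s := P.support) fun n hn => termAt_coe_eq_zero P v hn,
    MvPolynomial.eval_eq']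
  refine Finset.sum_congr rfl fun n _ => ?_
  simp [termAt, monoWt, Fin.prod_univ_two]

end polynomials

/-! ### The inverse of a linear factor. -/

/-- The coefficients of `1 / (1 - α z - β w)`. -/
noncomputable def linearInv (α β : ℝ) : MvPowerSeries (Fin 2) ℂ :=
  fun n => (((n 0 + n 1).choose (n 0) : ℝ) * α ^ n 0 * β ^ n 1 : ℝ)

theorem coeff_linearInv (α β : ℝ) (n : Fin 2 →₀ ℕ) :
    MvPowerSeries.coeff n (linearInv α β) =
      (((n 0 + n 1).choose (n 0) : ℝ) * α ^ n 0 * β ^ n 1 : ℝ) := rfl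

theorem coe_linearFactor (α β : ℝ) :
    (linearFactor α β : MvPowerSeries (Fin 2) ℂ) =
      1 - MvPowerSeries.C (α : ℂ) * MvPowerSeries.X 0 -
        MvPowerSeries.C (β : ℂ) * MvPowerSeries.X 1 := by
  rw [linearFactor, eq_sub_iff_add_eq, eq_sub_iff_add_eq]
  rw [← MvPolynomial.coe_C, ← MvPolynomial.coe_X, ← MvPolynomial.coe_C, ← MvPolynomial.coe_X,
    ← MvPolynomial.coe_mul, ← MvPolynomial.coe_mul, ← MvPolynomial.coe_add,
    ← MvPolynomial.coe_add, ← MvPolynomial.coe_one]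
  congr 1
  ring

/-- Coefficientwise this is Pascal's rule; the exponents on the two axes are separate cases. -/
theorem linearFactor_mul_linearInv (α β : ℝ) :
    (linearFactor α β : MvPowerSeries (Fin 2) ℂ) * linearInv α β = 1 := by
  rw [coe_linearFactor, sub_mul, sub_mul, one_mul, mul_assoc, mul_assoc]
  ext n
  rw [← expo_self n]
  generalize n 0 = x
  generalize n 1 = y
  rw [map_sub, map_sub, MvPowerSeries.coeff_C_mul, MvPowerSeries.coeff_C_mul]
  rcases x with _ | x <;> rcases y with _ | y <;>
    simp only [coeff_expo_zero_X_zero_mul, coeff_expo_zero_X_one_mul, coeff_expo_succ_X_zero_mul,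
      coeff_expo_succ_X_one_mul, coeff_linearInv, expo_apply_zero, expo_apply_one]
  · simp [expo]
  · rw [MvPowerSeries.coeff_one, if_neg]
    · simp; ring
    · intro h
      simpa [expo] using DFunLike.congr_fun h 1
  · rw [MvPowerSeries.coeff_one, if_neg]
    · simp; ring
    · intro h
      simpa [expo] using DFunLike.congr_fun h 0
  · rw [MvPowerSeries.coeff_one, if_neg]
    · have h : (x + 1 + (y + 1)).choose (x + 1) =
          (x + (y + 1)).choose x + (x + 1 + y).choose (x + 1) := by
        rw [show x + 1 + (y + 1) = (x + y + 1) + 1 by ring, Nat.choose_succ_succ,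
          show x + (y + 1) = x + y + 1 by ring, show x + 1 + y = x + y + 1 by ring]
      rw [h]
      push_cast
      ring
    · intro h
      simpa [expo] using DFunLike.congr_fun h 0

/-- Grouped by total degree, the binomial theorem turns the series into a geometric one of ratio `α
* v.1 + β * v.2`. -/
theorem absConv_linearInv {α β : ℝ} (hα : 0 < α) (hβ : 0 < β) {v : ℝ × ℝ} (h1 : 0 < v.1)
    (h2 : 0 < v.2) (h : α * v.1 + β * v.2 < 1) : AbsConv (linearInv α β) v := by
  have hpos : 0 < α * v.1 + β * v.2 := by positivity
  have key : Summable fun t : ℕ × ℕ =>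
      ((t.1 + t.2).choose t.1 : ℝ) * (α * v.1) ^ t.1 * (β * v.2) ^ t.2 := by
    rw [← Finset.HasAntidiagonal.sigmaAntidiagonalEquivProd.summable_iff]
    rw [summable_sigma_of_nonneg]
    · refine ⟨fun n => Summable.of_finite, ?_⟩
      refine (summable_geometric_of_lt_one hpos.le h).congr fun n => ?_
      rw [tsum_fintype, Finset.univ_eq_attach, (Commute.all _ _).add_pow']
      rw [← Finset.sum_attach]
      refine Finset.sum_congr rfl fun t _ => ?_
      obtain ⟨⟨x, y⟩, ht⟩ := t
      simp only [Function.comp, Finset.HasAntidiagonal.sigmaAntidiagonalEquivProd_apply, nsmul_eq_mul]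
      rw [Finset.HasAntidiagonal.mem_antidiagonal.mp ht]
      ring
    · intro t
      simp only [Function.comp]
      positivity
  rw [AbsConv, ← expoEquiv.summable_iff]
  refine key.congr fun t => ?_
  simp only [Function.comp, expoEquiv, Equiv.coe_fn_mk, termAt, coeff_linearInv, monoWt,
    expo_apply_zero, expo_apply_one]
  rw [← Complex.ofReal_mul, Complex.norm_real, Real.norm_of_nonneg (by positivity)]
  ring

/-! ### Binomial distribution: concentration. -/

/-- The probability of `ν` successes in `N` independent trials of success probability `s`. -/
def binomPmf (s : ℝ) (N ν : ℕ) : ℝ := (N.choose ν : ℝ) * s ^ ν * (1 - s) ^ (N - ν)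

theorem binomPmf_nonneg {s : ℝ} (h0 : 0 ≤ s) (h1 : s ≤ 1) (N ν : ℕ) : 0 ≤ binomPmf s N ν := by
  have : 0 ≤ 1 - s := by linarith
  unfold binomPmf
  positivity

theorem eval_bernsteinPolynomial (s : ℝ) (N ν : ℕ) :
    (bernsteinPolynomial ℝ N ν).eval s = binomPmf s N ν := by
  simp [bernsteinPolynomial, binomPmf]

theorem sum_binomPmf (s : ℝ) (N : ℕ) : ∑ ν ∈ Finset.range (N + 1), binomPmf s N ν = 1 := by
  have h := congrArg (Polynomial.eval s) (bernsteinPolynomial.sum ℝ N)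
  simpa [Polynomial.eval_finsetSum, eval_bernsteinPolynomial] using h

theorem sum_sq_mul_binomPmf (s : ℝ) (N : ℕ) :
    ∑ ν ∈ Finset.range (N + 1), (N * s - ν) ^ 2 * binomPmf s N ν = N * s * (1 - s) := by
  have h := congrArg (Polynomial.eval s) (bernsteinPolynomial.variance ℝ N)
  simpa [Polynomial.eval_finsetSum, eval_bernsteinPolynomial] using h

theorem binomPmf_le_one {s : ℝ} (h0 : 0 ≤ s) (h1 : s ≤ 1) {N ν : ℕ} (h : ν ≤ N) :
    binomPmf s N ν ≤ 1 := by
  rw [← sum_binomPmf s N]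
  exact Finset.single_le_sum (fun i _ => binomPmf_nonneg h0 h1 N i)
    (Finset.mem_range.mpr (Nat.lt_succ_of_le h))

/-- Chebyshev's inequality for the binomial distribution. -/
theorem sum_binomPmf_le_of_dist {s : ℝ} (h0 : 0 ≤ s) (h1 : s ≤ 1) {N : ℕ} {S : Finset ℕ}
    (hS : S ⊆ Finset.range (N + 1)) {η : ℝ} (hη : 0 < η) (hN : 0 < N)
    (hd : ∀ ν ∈ S, N * η ≤ |N * s - ν|) :
    ∑ ν ∈ S, binomPmf s N ν ≤ 1 / (N * η ^ 2) := by
  have hN' : (0 : ℝ) < N := Nat.cast_pos.mpr hN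
  have h2 : (N * η) ^ 2 * ∑ ν ∈ S, binomPmf s N ν ≤ N := by
    calc (N * η) ^ 2 * ∑ ν ∈ S, binomPmf s N ν
        ≤ ∑ ν ∈ S, (N * s - ν) ^ 2 * binomPmf s N ν := by
          rw [Finset.mul_sum]
          refine Finset.sum_le_sum fun ν hν => ?_
          refine mul_le_mul_of_nonneg_right ?_ (binomPmf_nonneg h0 h1 N ν)
          rw [← sq_abs (N * s - ν)]
          exact pow_le_pow_left₀ (by positivity) (hd ν hν) 2
      _ ≤ ∑ ν ∈ Finset.range (N + 1), (N * s - ν) ^ 2 * binomPmf s N ν :=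
          Finset.sum_le_sum_of_subset_of_nonneg hS fun ν _ _ =>
            mul_nonneg (sq_nonneg _) (binomPmf_nonneg h0 h1 N ν)
      _ = N * (s * (1 - s)) := by rw [sum_sq_mul_binomPmf, mul_assoc]
      _ ≤ N * 1 := mul_le_mul_of_nonneg_left (by nlinarith) hN'.le
      _ = N := mul_one _
  rw [le_div_iff₀ (by positivity)]
  have h3 : (N : ℝ) * ((∑ ν ∈ S, binomPmf s N ν) * (N * η ^ 2)) ≤ N * 1 := by linarith
  exact le_of_mul_le_mul_left h3 hN'

/-- The distribution function of the binomial distribution. -/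
def binomCdf (s : ℝ) (N x : ℕ) : ℝ := ∑ ν ∈ Finset.range (x + 1), binomPmf s N ν

theorem binomCdf_nonneg {s : ℝ} (h0 : 0 ≤ s) (h1 : s ≤ 1) (N x : ℕ) : 0 ≤ binomCdf s N x :=
  Finset.sum_nonneg fun ν _ => binomPmf_nonneg h0 h1 N ν

theorem binomCdf_le_one {s : ℝ} (h0 : 0 ≤ s) (h1 : s ≤ 1) {N x : ℕ} (h : x ≤ N) :
    binomCdf s N x ≤ 1 := by
  rw [← sum_binomPmf s N]
  exact Finset.sum_le_sum_of_subset_of_nonneg (Finset.range_mono (Nat.succ_le_succ h))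
    fun ν _ _ => binomPmf_nonneg h0 h1 N ν

section limits

variable {s r : ℝ} (h0 : 0 ≤ s) (h1 : s ≤ 1) {N x : ℕ → ℕ} (hN : Tendsto N atTop atTop)
  (hx : Tendsto (fun k => (x k : ℝ) / N k) atTop (𝓝 r))

theorem tendsto_one_div_natCast_mul {N : ℕ → ℕ} (hN : Tendsto N atTop atTop) {c : ℝ}
    (hc : 0 < c) : Tendsto (fun k => 1 / ((N k : ℝ) * c)) atTop (𝓝 0) := by
  simp_rw [one_div]
  exact tendsto_inv_atTop_zero.comp
    ((tendsto_natCast_atTop_atTop.comp hN).atTop_mul_const hc)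

-- Weak law of large numbers: eventually `x k` is below the mean `s * N k` by at least `N k * (s -
-- r) / 2`, so Chebyshev bounds the whole lower tail.
include h0 h1 hN hx in
theorem tendsto_binomCdf_zero (hxN : ∀ k, x k ≤ N k) (hrs : r < s) :
    Tendsto (fun k => binomCdf s (N k) (x k)) atTop (𝓝 0) := by
  have hη : 0 < (s - r) / 2 := by linarith
  refine tendsto_of_tendsto_of_tendsto_of_le_of_le' tendsto_const_nhds
    (tendsto_one_div_natCast_mul hN (pow_pos hη 2))
    (Eventually.of_forall fun k => binomCdf_nonneg h0 h1 _ _) ?_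
  filter_upwards [hN.eventually_gt_atTop 0,
    hx.eventually (gt_mem_nhds (show r < (s + r) / 2 by linarith))] with k hk hk2
  have hN' : (0 : ℝ) < N k := Nat.cast_pos.mpr hk
  rw [div_lt_iff₀ hN'] at hk2
  refine sum_binomPmf_le_of_dist h0 h1 (Finset.range_mono (Nat.succ_le_succ (hxN k))) hη hk
    fun ν hν => le_trans ?_ (le_abs_self _)
  have : (ν : ℝ) ≤ x k := Nat.cast_le.mpr (Nat.lt_succ_iff.mp (Finset.mem_range.mp hν))
  nlinarith

include h0 h1 hN hx in
theorem tendsto_binomCdf_one (hxN : ∀ k, x k ≤ N k) (hrs : s < r) :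
    Tendsto (fun k => binomCdf s (N k) (x k)) atTop (𝓝 1) := by
  have hη : 0 < (r - s) / 2 := by linarith
  have hlow : Tendsto (fun k => 1 - 1 / ((N k : ℝ) * ((r - s) / 2) ^ 2)) atTop (𝓝 1) := by
    simpa using (tendsto_one_div_natCast_mul hN (pow_pos hη 2)).const_sub 1
  refine tendsto_of_tendsto_of_tendsto_of_le_of_le' hlow tendsto_const_nhds ?_
    (Eventually.of_forall fun k => binomCdf_le_one h0 h1 (hxN k))
  filter_upwards [hN.eventually_gt_atTop 0,
    hx.eventually (lt_mem_nhds (show (s + r) / 2 < r by linarith))] with k hk hk2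
  have hN' : (0 : ℝ) < N k := Nat.cast_pos.mpr hk
  rw [lt_div_iff₀ hN'] at hk2
  have hsub : Finset.range (x k + 1) ⊆ Finset.range (N k + 1) :=
    Finset.range_mono (Nat.succ_le_succ (hxN k))
  have h2 := Finset.sum_sdiff hsub (f := binomPmf s (N k))
  rw [sum_binomPmf] at h2
  have h3 : ∑ ν ∈ Finset.range (N k + 1) \ Finset.range (x k + 1), binomPmf s (N k) ν ≤
      1 / ((N k : ℝ) * ((r - s) / 2) ^ 2) := by
    refine sum_binomPmf_le_of_dist h0 h1 Finset.sdiff_subset hη hk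
      fun ν hν => le_trans ?_ (neg_le_abs _)
    have h4 : x k + 1 ≤ ν := by
      have := (Finset.mem_sdiff.mp hν).2
      rw [Finset.mem_range] at this
      omega
    have h5 : (x k : ℝ) ≤ ν := Nat.cast_le.mpr (by omega)
    nlinarith
  rw [binomCdf]
  linarith

end limits

/-! ### Binomial weights: mode, growth and slow variation. -/

/-- The coefficient of `z ^ x * w ^ y` in `1 / (1 - s z - (1 - s) w)`. -/
def binomWt (s : ℝ) (x y : ℕ) : ℝ := binomPmf s (x + y) x

theorem binomWt_eq (s : ℝ) (x y : ℕ) :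
    binomWt s x y = ((x + y).choose x : ℝ) * s ^ x * (1 - s) ^ y := by
  rw [binomWt, binomPmf, Nat.add_sub_cancel_left]

theorem binomWt_symm (s : ℝ) (x y : ℕ) : binomWt (1 - s) y x = binomWt s x y := by
  rw [binomWt_eq, binomWt_eq, Nat.choose_symm_add, add_comm y x]
  rw [sub_sub_cancel]
  ring

theorem binomWt_pos {s : ℝ} (h0 : 0 < s) (h1 : s < 1) (x y : ℕ) : 0 < binomWt s x y := by
  have h2 : 0 < 1 - s := by linarith
  have h3 : 0 < (x + y).choose x := Nat.choose_pos (Nat.le_add_right x y)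
  rw [binomWt_eq]
  positivity

theorem binomWt_le_one {s : ℝ} (h0 : 0 < s) (h1 : s < 1) (x y : ℕ) : binomWt s x y ≤ 1 :=
  binomPmf_le_one h0.le h1.le (Nat.le_add_right x y)

theorem binomWt_succ_left (s : ℝ) (x y : ℕ) :
    binomWt s (x + 1) y * (x + 1) = binomWt s x y * (s * (x + y + 1)) := by
  have h : ((x + y + 1 : ℕ) : ℝ) * ((x + y).choose x : ℕ) =
      ((x + 1 + y).choose (x + 1) : ℕ) * ((x + 1 : ℕ) : ℝ) := by
    rw [← Nat.cast_mul, ← Nat.cast_mul, Nat.add_one_mul_choose_eq, add_right_comm]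
  rw [binomWt_eq, binomWt_eq, pow_succ]
  push_cast at h
  linear_combination (-(s ^ x * s * (1 - s) ^ y)) * h

/-- The sequence `ν ↦ x ^ ν / ν!` is largest at `ν = x`; this is that fact with denominators
cleared. -/
theorem factorial_mul_pow_le (x ν : ℕ) :
    x.factorial * x ^ ν ≤ ν.factorial * x ^ x := by
  rcases le_total x ν with h | h
  · obtain ⟨d, rfl⟩ := Nat.exists_eq_add_of_le h
    calc x.factorial * x ^ (x + d) = x.factorial * x ^ d * x ^ x := by ring
      _ ≤ (x + d).factorial * x ^ x := by
        refine Nat.mul_le_mul_right _ ((Nat.mul_le_mul_left _ ?_).trans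
          Nat.factorial_mul_pow_le_factorial)
        exact Nat.pow_le_pow_left (Nat.le_succ x) d
  · obtain ⟨d, rfl⟩ := Nat.exists_eq_add_of_le h
    calc (ν + d).factorial * (ν + d) ^ ν ≤ (ν.factorial * (ν + d) ^ d) * (ν + d) ^ ν :=
          by
          rw [← Nat.factorial_mul_ascFactorial]
          exact Nat.mul_le_mul_right _ (Nat.mul_le_mul_left _ (Nat.ascFactorial_le_pow_add ν d))
      _ = ν.factorial * (ν + d) ^ (ν + d) := by ring

theorem pow_div_factorial_le (x ν : ℕ) :
    (x : ℝ) ^ ν / ν.factorial ≤ (x : ℝ) ^ x / x.factorial := by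
  rw [div_le_div_iff₀ (by positivity) (by positivity)]
  have h := factorial_mul_pow_le x ν
  have h2 : ((x.factorial * x ^ ν : ℕ) : ℝ) ≤ (ν.factorial * x ^ x : ℕ) := Nat.cast_le.mpr h
  push_cast at h2
  linarith

/-- When the mean is the integer `x`, the probability splits into two factors of the form `x ^ ν /
ν!`, each maximal at the mean; hence the mode is there. -/
theorem binomPmf_mul_pow {r : ℝ} {x y : ℕ} (hr : (x : ℝ) = r * (x + y)) {ν : ℕ}
    (hν : ν ≤ x + y) :
    binomPmf r (x + y) ν * (x + y : ℝ) ^ (x + y) =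
      (x + y).factorial * ((x : ℝ) ^ ν / ν.factorial) *
        ((y : ℝ) ^ (x + y - ν) / (x + y - ν).factorial) := by
  have hr2 : (y : ℝ) = (1 - r) * (x + y) := by linarith
  have h1 : (x : ℝ) ^ ν = r ^ ν * (x + y) ^ ν := by rw [← mul_pow, ← hr]
  have h2 : (y : ℝ) ^ (x + y - ν) = (1 - r) ^ (x + y - ν) * (x + y) ^ (x + y - ν) := by
    rw [← mul_pow, ← hr2]
  have h3 : (x + y : ℝ) ^ (x + y) = (x + y) ^ ν * (x + y) ^ (x + y - ν) := by
    rw [← pow_add, Nat.add_sub_cancel' hν]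
  have h4 : (((x + y).choose ν : ℕ) : ℝ) =
      (x + y).factorial / (ν.factorial * (x + y - ν).factorial) := Nat.cast_choose ℝ hν
  rw [binomPmf, h1, h2, h3, h4]
  field_simp

/-- The binomial distribution of integral mean `x` has a mode at `x`. -/
theorem one_le_mul_binomWt {r : ℝ} {x y : ℕ} (hr : (x : ℝ) = r * (x + y)) :
    1 ≤ (x + y + 1) * binomWt r x y := by
  rcases Nat.eq_zero_or_pos (x + y) with h | h
  · obtain ⟨rfl, rfl⟩ : x = 0 ∧ y = 0 := by omega
    simp [binomWt_eq]
  have hN : (0 : ℝ) < x + y := by exact_mod_cast h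
  have hmode : ∀ ν ∈ Finset.range (x + y + 1), binomPmf r (x + y) ν ≤ binomWt r x y := by
    intro ν hν
    have hν' : ν ≤ x + y := Nat.lt_succ_iff.mp (Finset.mem_range.mp hν)
    refine le_of_mul_le_mul_right ?_ (pow_pos hN (x + y))
    rw [binomWt, binomPmf_mul_pow hr hν', binomPmf_mul_pow hr (Nat.le_add_right x y),
      Nat.add_sub_cancel_left]
    gcongr ?_ * ?_ * ?_
    · exact pow_div_factorial_le x ν
    · exact pow_div_factorial_le y _
  calc (1 : ℝ) = ∑ ν ∈ Finset.range (x + y + 1), binomPmf r (x + y) ν := (sum_binomPmf r _).symm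
    _ ≤ ∑ ν ∈ Finset.range (x + y + 1), binomWt r x y := Finset.sum_le_sum hmode
    _ = (x + y + 1) * binomWt r x y := by simp

/-- Raising `x` by one multiplies the weight by `r (x + y + 1) / (x + 1)`; the hypothesis keeps each
of the `α` such factors at least `1 / K`. -/
theorem binomWt_le_left {r K : ℝ} (h0 : 0 < r) (h1 : r < 1) (hK : 0 < K) (x y α : ℕ)
    (hx : (x + α : ℝ) ≤ r * K * (x + y + 1)) :
    binomWt r x y ≤ K ^ α * binomWt r (x + α) y := by
  induction α with
  | zero => simp
  | succ α ih =>
    push_cast at hx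
    refine (ih (by linarith)).trans ?_
    rw [pow_succ, mul_assoc]
    refine mul_le_mul_of_nonneg_left ?_ (by positivity)
    have h := binomWt_succ_left r (x + α) y
    push_cast at h
    have hp : 0 < r * ((x : ℝ) + α + y + 1) := by positivity
    refine le_of_mul_le_mul_right ?_ hp
    rw [← h, ← add_assoc, mul_comm K, mul_assoc]
    refine mul_le_mul_of_nonneg_left ?_ (binomWt_pos h0 h1 _ _).le
    have : 0 ≤ r * K * α := by positivity
    linarith

theorem binomWt_le_pow_mul {r K : ℝ} (h0 : 0 < r) (h1 : r < 1) (hK : 0 < K) (x y α β : ℕ)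
    (hx : (x + α : ℝ) ≤ r * K * (x + y + 1)) (hy : (y + β : ℝ) ≤ (1 - r) * K * (x + y + 1)) :
    binomWt r x y ≤ K ^ (α + β) * binomWt r (x + α) (y + β) := by
  refine (binomWt_le_left h0 h1 hK x y α hx).trans ?_
  rw [pow_add, mul_assoc]
  refine mul_le_mul_of_nonneg_left ?_ (by positivity)
  rw [← binomWt_symm r, ← binomWt_symm r (x + α)]
  refine binomWt_le_left (by linarith) (by linarith) hK y (x + α) β (hy.trans ?_)
  have : 0 ≤ (1 - r) * K * α := mul_nonneg (mul_nonneg (by linarith) hK.le) (Nat.cast_nonneg α)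
  push_cast
  linarith

/-- Away from the mode, the binomial weights grow at most like a given geometric sequence. -/
theorem exists_binomWt_sub_le {r K c A : ℝ} (h0 : 0 < r) (h1 : r < 1) (hK : 1 < K) (hc : 0 < c)
    {x y : ℕ → ℕ} (hN : Tendsto (fun k => x k + y k) atTop atTop)
    (hx : ∀ k, (x k : ℝ) ≤ r * (x k + y k + A)) (hy : ∀ k, (y k : ℝ) ≤ (1 - r) * (x k + y k + A))
    (hlow : ∀ᶠ k in atTop, c ≤ (x k + y k + 1) * binomWt r (x k) (y k)) :
    ∃ C, 0 ≤ C ∧ ∀ᶠ k in atTop, ∀ α ≤ x k, ∀ β ≤ y k,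
      binomWt r (x k - α) (y k - β) ≤ C * K ^ (α + β) * binomWt r (x k) (y k) := by
  have hK0 : 0 < K := by linarith
  have hK1 : 0 < K - 1 := by linarith
  have hr1 : 0 < 1 - r := by linarith
  -- `D` serves large shifts: there `K ^ (α + β)` dominates the total degree, while the weight at
  -- the unshifted point is at least `c` over the degree plus one.
  set D : ℝ := (2 * K / (K - 1) ^ 2 + 1) / c with hD
  have hD0 : 0 < D := by positivity
  refine ⟨1 + D, by positivity, ?_⟩
  filter_upwards [(tendsto_natCast_atTop_atTop.comp hN).eventually_ge_atTop (2 * A / (K - 1)), hlow]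
    with k hk hl α hα β hβ
  simp only [Function.comp, Nat.cast_add] at hk
  rw [div_le_iff₀ hK1] at hk
  obtain ⟨x', hx'⟩ := Nat.exists_eq_add_of_le' hα
  obtain ⟨y', hy'⟩ := Nat.exists_eq_add_of_le' hβ
  have hxk := hx k
  have hyk := hy k
  rw [hx', hy'] at hk hxk hyk hl ⊢
  rw [Nat.add_sub_cancel, Nat.add_sub_cancel]
  push_cast at hk hxk hyk hl
  have hpos := binomWt_pos h0 h1 (x' + α) (y' + β)
  have hKn : (1 : ℝ) ≤ K ^ (α + β) := one_le_pow₀ hK.le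
  -- With `N` the total degree, shifts of size at most `(K - 1) N / (2 K)` leave every one-step
  -- ratio at least `1 / K`. For larger shifts the left weight is merely bounded by `1`, and
  -- Bernoulli's inequality makes `K ^ (α + β)` at least of order `N`.
  rcases le_or_gt ((α + β : ℝ) * (2 * K)) ((K - 1) * (x' + α + (y' + β))) with hcase | hcase
  · have hmain : (x' : ℝ) + α + (y' + β) + A ≤ K * (x' + y' + 1) := by
      linarith
    refine (binomWt_le_pow_mul h0 h1 hK0 x' y' α β ?_ ?_).trans ?_
    · rw [mul_assoc]
      exact hxk.trans (mul_le_mul_of_nonneg_left hmain h0.le)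
    · rw [mul_assoc]
      exact hyk.trans (mul_le_mul_of_nonneg_left hmain hr1.le)
    · refine mul_le_mul_of_nonneg_right ?_ hpos.le
      nlinarith
  · have hbern : ((α + β : ℕ) : ℝ) * (K - 1) ≤ K ^ (α + β) := by
      have := one_add_mul_le_pow (show (-2 : ℝ) ≤ K - 1 by linarith) (α + β)
      rw [add_sub_cancel] at this
      linarith
    push_cast at hbern
    have hN2 : (x' : ℝ) + α + (y' + β) + 1 ≤ c * D * K ^ (α + β) := by
      have e : c * D = 2 * K / (K - 1) ^ 2 + 1 := by rw [hD]; field_simp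
      rw [e, add_mul, one_mul]
      refine add_le_add ?_ hKn
      rw [div_mul_eq_mul_div, le_div_iff₀ (by positivity)]
      nlinarith
    refine (binomWt_le_one h0 h1 x' y').trans ?_
    have h3 : c * 1 ≤ c * (D * K ^ (α + β) * binomWt r (x' + α) (y' + β)) := by
      calc c * 1 ≤ ((x' : ℝ) + α + (y' + β) + 1) * binomWt r (x' + α) (y' + β) := by linarith
        _ ≤ (c * D * K ^ (α + β)) * binomWt r (x' + α) (y' + β) :=
          mul_le_mul_of_nonneg_right hN2 hpos.le
        _ = _ := by ring
    refine (le_of_mul_le_mul_left h3 hc).trans ?_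
    refine mul_le_mul_of_nonneg_right ?_ hpos.le
    nlinarith

section ratio

variable {r : ℝ} (h0 : 0 < r) (h1 : r < 1)

include h0 h1 in
theorem tendsto_binomWt_succ_left_div {x y : ℕ → ℕ}
    (hN : Tendsto (fun k => x k + y k) atTop atTop)
    (hx : Tendsto (fun k => (x k : ℝ) / (x k + y k : ℕ)) atTop (𝓝 r)) :
    Tendsto (fun k => binomWt r (x k + 1) (y k) / binomWt r (x k) (y k)) atTop (𝓝 1) := by
  have hinv : Tendsto (fun k => 1 / ((x k + y k : ℕ) : ℝ)) atTop (𝓝 0) := by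
    simpa using tendsto_one_div_natCast_mul hN one_pos
  have h := ((hinv.const_add 1).const_mul r).div (hx.add hinv) (by linarith)
  rw [add_zero, add_zero, mul_one, div_self h0.ne'] at h
  refine h.congr' ?_
  filter_upwards [hN.eventually_gt_atTop 0] with k hk
  have hN' : (0 : ℝ) < (x k + y k : ℕ) := Nat.cast_pos.mpr hk
  have e := binomWt_succ_left r (x k) (y k)
  have hp := binomWt_pos h0 h1 (x k) (y k)
  have hx1 : (0 : ℝ) < x k + 1 := by positivity
  rw [eq_div_of_mul_eq hx1.ne' e]
  simp only [Pi.div_apply]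
  push_cast at hN' ⊢
  field_simp

end ratio

/-! ### Exponents tending to infinity in a fixed direction. -/

/-- The sequence of exponents `(x k, y k)` tends to infinity in the direction `(r, 1 - r)`. -/
structure TendstoDir (r : ℝ) (x y : ℕ → ℕ) : Prop where
  left : Tendsto x atTop atTop
  right : Tendsto y atTop atTop
  ratio : Tendsto (fun k => (x k : ℝ) / (x k + y k : ℕ)) atTop (𝓝 r)

namespace TendstoDir

variable {r : ℝ} {x y : ℕ → ℕ}

theorem add (h : TendstoDir r x y) : Tendsto (fun k => x k + y k) atTop atTop :=
  h.left.atTop_add_nonneg fun _ => Nat.zero_le _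

theorem tendsto_const_div (h : TendstoDir r x y) (c : ℝ) :
    Tendsto (fun k => c / ((x k + y k : ℕ) : ℝ)) atTop (𝓝 0) :=
  (tendsto_natCast_atTop_atTop.comp h.add).const_div_atTop c

theorem symm (h : TendstoDir r x y) : TendstoDir (1 - r) y x where
  left := h.right
  right := h.left
  ratio := by
    refine (h.ratio.const_sub 1).congr' ?_
    filter_upwards [h.add.eventually_gt_atTop 0] with k hk
    have hk' : (0 : ℝ) < (x k + y k : ℕ) := Nat.cast_pos.mpr hk
    rw [add_comm (y k) (x k)]
    push_cast at hk' ⊢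
    field_simp
    ring

theorem sub (h : TendstoDir r x y) (α β : ℕ) :
    TendstoDir r (fun k => x k - α) (fun k => y k - β) where
  left := (tendsto_sub_atTop_nat α).comp h.left
  right := (tendsto_sub_atTop_nat β).comp h.right
  ratio := by
    have h2 := (h.ratio.sub (h.tendsto_const_div α)).div
      ((h.tendsto_const_div (α + β)).const_sub 1) (by norm_num)
    simp only [sub_zero, div_one] at h2
    refine h2.congr' ?_
    filter_upwards [h.left.eventually_ge_atTop (α + 1), h.right.eventually_ge_atTop (β + 1)]
      with k hk1 hk2
    have e1 : ((x k - α : ℕ) : ℝ) = x k - α := Nat.cast_sub (by omega)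
    have e2 : ((y k - β : ℕ) : ℝ) = y k - β := Nat.cast_sub (by omega)
    have h1' : (α + 1 : ℝ) ≤ x k := by exact_mod_cast hk1
    have h2' : (β + 1 : ℝ) ≤ y k := by exact_mod_cast hk2
    have p1 : (0 : ℝ) ≤ α := Nat.cast_nonneg α
    have p2 : (0 : ℝ) ≤ β := Nat.cast_nonneg β
    have h3 : (x k + y k : ℝ) ≠ 0 := by linarith
    have h4 : (x k - α + (y k - β) : ℝ) ≠ 0 := by linarith
    simp only [Pi.div_apply]
    push_cast
    rw [e1, e2]
    have h5 : 1 - (α + β) / (x k + y k : ℝ) ≠ 0 := by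
      rw [one_sub_div h3]
      exact div_ne_zero (by intro h; apply h4; linarith) h3
    rw [div_eq_div_iff h5 h4]
    field_simp
    ring

theorem affine {p q : ℕ} (hp : 0 < p) (hq : 0 < q) (ε δ : ℕ) :
    TendstoDir ((p : ℝ) / (p + q)) (fun k => k * p + ε) (fun k => k * q + δ) where
  left := (tendsto_id.atTop_mul_const' hp).atTop_add_nonneg fun _ => Nat.zero_le _
  right := (tendsto_id.atTop_mul_const' hq).atTop_add_nonneg fun _ => Nat.zero_le _
  ratio := by
    have hp' : (0 : ℝ) < p := Nat.cast_pos.mpr hp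
    have hq' : (0 : ℝ) < q := Nat.cast_pos.mpr hq
    have h1 : ∀ c : ℝ, Tendsto (fun k : ℕ => c / (k : ℝ)) atTop (𝓝 0) := fun c =>
      tendsto_natCast_atTop_atTop.const_div_atTop c
    have h2 := ((h1 ε).const_add (p : ℝ)).div ((h1 (ε + δ)).const_add (p + q : ℝ)) (by linarith)
    simp only [add_zero] at h2
    refine h2.congr' ?_
    filter_upwards [eventually_gt_atTop 0] with k hk
    have hk' : (0 : ℝ) < k := Nat.cast_pos.mpr hk
    simp only [Pi.div_apply]
    push_cast
    rw [← mul_div_mul_left _ _ hk'.ne']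
    congr 1 <;> field_simp
    ring

theorem binomWt_sub_left (h : TendstoDir r x y) (h0 : 0 < r) (h1 : r < 1) (α : ℕ) :
    Tendsto (fun k => binomWt r (x k - α) (y k) / binomWt r (x k) (y k)) atTop (𝓝 1) := by
  induction α with
  | zero =>
    refine tendsto_const_nhds.congr fun k => ?_
    rw [Nat.sub_zero, div_self (binomWt_pos h0 h1 _ _).ne']
  | succ α ih =>
    have h2 := h.sub (α + 1) 0
    have h3 := ih.mul ((tendsto_binomWt_succ_left_div h0 h1 h2.add h2.ratio).inv₀ one_ne_zero)
    rw [inv_one, mul_one] at h3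
    refine h3.congr' ?_
    filter_upwards [h.left.eventually_ge_atTop (α + 1)] with k hk
    have e : x k - (α + 1) + 1 = x k - α := by omega
    have p1 := (binomWt_pos h0 h1 (x k - α) (y k)).ne'
    have p2 := (binomWt_pos h0 h1 (x k) (y k)).ne'
    rw [Nat.sub_zero, e, inv_div]
    field_simp

/-- Shift the first coordinate, then the second by exchanging the roles of success and failure. -/
theorem binomWt_sub (h : TendstoDir r x y) (h0 : 0 < r) (h1 : r < 1) (α β : ℕ) :
    Tendsto (fun k => binomWt r (x k - α) (y k - β) / binomWt r (x k) (y k)) atTop (𝓝 1) := by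
  have h2 := h.binomWt_sub_left h0 h1 α
  have h3 := (h.sub α 0).symm.binomWt_sub_left (by linarith) (by linarith) β
  have h4 := h2.mul h3
  rw [one_mul] at h4
  refine h4.congr fun k => ?_
  have p1 := (binomWt_pos h0 h1 (x k - α) (y k)).ne'
  simp only [Nat.sub_zero]
  rw [binomWt_symm, binomWt_symm]
  field_simp

end TendstoDir

/-! ### Weights of a product of two inverse linear factors. -/

/-- The coefficient of `z ^ x * w ^ y` in
`1 / ((1 - s z - (1 - s) w) * (1 - t z - (1 - t) w))`. -/
noncomputable def crossWt (s t : ℝ) (x y : ℕ) : ℝ :=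
  (binomCdf s (x + y + 1) x - binomCdf t (x + y + 1) x) / (t - s)

theorem abs_crossWt_le {s t : ℝ} (hs0 : 0 ≤ s) (hs1 : s ≤ 1) (ht0 : 0 ≤ t) (ht1 : t ≤ 1)
    (x y : ℕ) : |crossWt s t x y| ≤ 1 / |t - s| := by
  rw [crossWt, abs_div]
  refine div_le_div_of_nonneg_right ?_ (abs_nonneg _)
  have h : x ≤ x + y + 1 := by omega
  have h1 := binomCdf_nonneg hs0 hs1 (x + y + 1) x
  have h2 := binomCdf_nonneg ht0 ht1 (x + y + 1) x
  have h3 := binomCdf_le_one hs0 hs1 h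
  have h4 := binomCdf_le_one ht0 ht1 h
  rw [abs_le]
  constructor <;> linarith

/-- Since `s < r < t`, the first distribution function tends to `1` and the second to `0`. -/
theorem TendstoDir.crossWt_sub {r s t : ℝ} {x y : ℕ → ℕ} (h : TendstoDir r x y) (hs : 0 ≤ s)
    (hsr : s < r) (hrt : r < t) (ht : t ≤ 1) (α β : ℕ) :
    Tendsto (fun k => crossWt s t (x k - α) (y k - β)) atTop (𝓝 (1 / (t - s))) := by
  have h2 := h.sub α β
  have hN : Tendsto (fun k => (x k - α) + (y k - β) + 1) atTop atTop :=
    h2.add.atTop_add_nonneg fun _ => Nat.zero_le _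
  have hx : Tendsto (fun k => ((x k - α : ℕ) : ℝ) / ((x k - α) + (y k - β) + 1 : ℕ)) atTop
      (𝓝 r) := by
    have h3 := h2.ratio.div ((h2.tendsto_const_div 1).const_add 1) (by norm_num)
    rw [add_zero, div_one] at h3
    refine h3.congr' ?_
    filter_upwards [h2.add.eventually_gt_atTop 0] with k hk
    have hk' : (0 : ℝ) < ((x k - α) + (y k - β) : ℕ) := Nat.cast_pos.mpr hk
    simp only [Pi.div_apply]
    rw [Nat.cast_add _ 1]
    generalize (((x k - α) + (y k - β) : ℕ) : ℝ) = n at hk' ⊢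
    push_cast
    field_simp
  have h4 := tendsto_binomCdf_one hs (by linarith) hN hx (fun k => by omega) hsr
  have h5 := tendsto_binomCdf_zero (by linarith) ht hN hx (fun k => by omega) hrt
  have h6 := (h4.sub h5).div_const (t - s)
  rw [sub_zero] at h6
  exact h6

theorem binomCdf_succ (s : ℝ) (N x : ℕ) :
    binomCdf s N (x + 1) = binomCdf s N x + binomPmf s N (x + 1) :=
  Finset.sum_range_succ _ _

/-- A double sequence satisfying the recurrence of the coefficients of
`1 / ((1 - s z - (1 - s) w) * (1 - t z - (1 - t) w))`. -/
theorem eq_crossWt {s t : ℝ} (hst : s ≠ t) {u : ℕ → ℕ → ℂ}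
    (hzero : ∀ y, ((t - s : ℝ) : ℂ) * u 0 y =
      (binomWt s 0 (y + 1) : ℝ) - (binomWt t 0 (y + 1) : ℝ))
    (hsucc : ∀ x y, ((t - s : ℝ) : ℂ) * (u (x + 1) y - u x (y + 1)) =
      (binomWt s (x + 1) (y + 1) : ℝ) - (binomWt t (x + 1) (y + 1) : ℝ)) (x y : ℕ) :
    u x y = (crossWt s t x y : ℝ) := by
  have hts : ((t - s : ℝ) : ℂ) ≠ 0 := Complex.ofReal_ne_zero.mpr (sub_ne_zero.mpr hst.symm)
  rw [crossWt, Complex.ofReal_div, eq_div_iff hts, Complex.ofReal_sub (binomCdf _ _ _)]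
  -- The recurrence links `(x + 1, y)` to `(x, y + 1)`, of equal total degree, so the number of
  -- trials stays fixed and the probabilities telescope into distribution functions.
  induction x generalizing y with
  | zero =>
    rw [mul_comm, hzero]
    simp only [binomWt, binomCdf, zero_add, Finset.sum_range_one]
  | succ x ih =>
    have h1 := hsucc x y
    have h2 := ih (y + 1)
    rw [binomCdf_succ, binomCdf_succ, Complex.ofReal_add, Complex.ofReal_add]
    simp only [binomWt] at h1
    have e1 : x + 1 + (y + 1) = x + 1 + y + 1 := by ring
    have e2 : x + (y + 1) + 1 = x + 1 + y + 1 := by ring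
    rw [e1] at h1
    rw [e2] at h2
    linear_combination h1 + h2

/-! ### Coefficient asymptotics by dominated convergence. -/

/-- Indicators put all the finite convolutions over one fixed index set, the form needed for
dominated convergence. -/
theorem sum_antidiagonal_eq_tsum (f g : (Fin 2 →₀ ℕ) → ℂ) (n : Fin 2 →₀ ℕ) :
    ∑ t ∈ Finset.HasAntidiagonal.antidiagonal n, f t.1 * g t.2 =
      ∑' α, (Set.Iic n).indicator (fun α => f α * g (n - α)) α := by
  classical
  rw [tsum_eq_sum (s := Finset.Iic n) fun α hα =>
    Set.indicator_of_notMem (fun h => hα (Finset.mem_Iic.mpr h)) _]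
  refine Finset.sum_bij' (fun t _ => t.1) (fun α _ => (α, n - α)) ?_ ?_ ?_ ?_ ?_
  · intro t ht
    rw [Finset.mem_Iic, ← Finset.HasAntidiagonal.mem_antidiagonal.mp ht]
    exact le_self_add
  · intro α hα
    exact Finset.HasAntidiagonal.mem_antidiagonal.mpr
      (add_tsub_cancel_of_le (Finset.mem_Iic.mp hα))
  · intro t ht
    ext1
    · rfl
    · exact (eq_tsub_of_add_eq
        ((add_comm _ _).trans (Finset.HasAntidiagonal.mem_antidiagonal.mp ht))).symm
  · intro α hα
    rfl
  · intro t ht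
    have h := Finset.HasAntidiagonal.mem_antidiagonal.mp ht
    rw [Set.indicator_of_mem (Set.mem_Iic.mpr (le_self_add.trans_eq h)),
      eq_tsub_of_add_eq ((add_comm _ _).trans h)]

theorem termAt_smul (φ : MvPowerSeries (Fin 2) ℂ) (K : ℝ) (v : ℝ × ℝ) (n : Fin 2 →₀ ℕ) :
    termAt φ (K • v) n = termAt φ v n * (K ^ (n 0 + n 1) : ℝ) := by
  simp only [termAt, monoWt, Prod.smul_fst, Prod.smul_snd, smul_eq_mul, mul_pow, pow_add]
  push_cast
  ring

/-- Asymptotics of the coefficients of a product `G * U`, where `G` converges absolutely and the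
coefficients of `U` vary slowly in a given direction. -/
theorem tendsto_termAt_mul_div {G U : MvPowerSeries (Fin 2) ℂ} {v : ℝ × ℝ} {K C ℓ : ℝ}
    (hK : 0 ≤ K) (hG : AbsConv G (K • v)) {u : ℕ → ℕ → ℝ}
    (hu : ∀ x y, termAt U v (expo x y) = u x y) {x y : ℕ → ℕ} (hx : Tendsto x atTop atTop)
    (hy : Tendsto y atTop atTop) {s : ℕ → ℝ} (hs : ∀ k, 0 < s k)
    (hbound : ∀ᶠ k in atTop, ∀ α ≤ x k, ∀ β ≤ y k,
      |u (x k - α) (y k - β)| ≤ C * K ^ (α + β) * s k)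
    (hlim : ∀ α β, Tendsto (fun k => u (x k - α) (y k - β) / s k) atTop (𝓝 ℓ)) :
    Tendsto (fun k => termAt (G * U) v (expo (x k) (y k)) / s k) atTop
      (𝓝 ((∑' n, termAt G v n) * ℓ)) := by
  have hterm : ∀ k, termAt (G * U) v (expo (x k) (y k)) / s k =
      ∑' α, (Set.Iic (expo (x k) (y k))).indicator
        (fun α => termAt G v α * ((u (x k - α 0) (y k - α 1) / s k : ℝ) : ℂ)) α := by
    intro k
    rw [termAt_mul, sum_antidiagonal_eq_tsum, ← tsum_div_const]
    refine tsum_congr fun α => ?_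
    by_cases hα : α ∈ Set.Iic (expo (x k) (y k))
    · rw [Set.indicator_of_mem hα, Set.indicator_of_mem hα]
      nth_rw 2 [← expo_self α]
      rw [expo_sub, hu, mul_div_assoc, Complex.ofReal_div]
    · rw [Set.indicator_of_notMem hα, Set.indicator_of_notMem hα, zero_div]
  simp_rw [hterm]
  rw [← tsum_mul_right]
  -- The growth factor `K ^ (α + β)` is absorbed by evaluating `G` at the dilated point `K • v`.
  refine tendsto_tsum_of_dominated_convergence (bound := fun α => ‖termAt G (K • v) α‖ * C)
    (Summable.mul_right C hG) ?_ ?_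
  · intro α
    have h1 : Tendsto (fun k => termAt G v α * ((u (x k - α 0) (y k - α 1) / s k : ℝ) : ℂ)) atTop
        (𝓝 (termAt G v α * ℓ)) :=
      ((Complex.continuous_ofReal.tendsto _).comp (hlim (α 0) (α 1))).const_mul _
    refine h1.congr' ?_
    filter_upwards [hx.eventually_ge_atTop (α 0), hy.eventually_ge_atTop (α 1)] with k hk1 hk2
    rw [Set.indicator_of_mem (Set.mem_Iic.mpr ((expo_le_iff _ _ _).mpr ⟨hk1, hk2⟩))]
  · filter_upwards [hbound] with k hk α
    by_cases hα : α ∈ Set.Iic (expo (x k) (y k))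
    · obtain ⟨h1, h2⟩ := (expo_le_iff _ _ _).mp (Set.mem_Iic.mp hα)
      rw [Set.indicator_of_mem hα, norm_mul, termAt_smul, norm_mul, Complex.norm_real,
        Complex.norm_real, mul_assoc]
      refine mul_le_mul_of_nonneg_left ?_ (norm_nonneg _)
      rw [Real.norm_of_nonneg (pow_nonneg hK _), Real.norm_eq_abs, abs_div, abs_of_pos (hs k),
        div_le_iff₀ (hs k), mul_comm (K ^ _) C]
      exact hk _ h1 _ h2
    · have h0 := hk 0 (Nat.zero_le _) 0 (Nat.zero_le _)
      have hC : 0 ≤ C := by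
        rw [Nat.add_zero, pow_zero, mul_one] at h0
        exact nonneg_of_mul_nonneg_left ((abs_nonneg _).trans h0) (hs k)
      rw [Set.indicator_of_notMem hα, norm_zero]
      positivity

/-- On the line the numbers `α * v.1` and `β * v.2` sum to `1`, so they are complementary
probabilities. -/
theorem termAt_linearInv (α β : ℝ) (v : ℝ × ℝ) (h : α * v.1 + β * v.2 = 1) (x y : ℕ) :
    termAt (linearInv α β) v (expo x y) = (binomWt (α * v.1) x y : ℝ) := by
  have e : 1 - α * v.1 = β * v.2 := by linarith
  rw [termAt, coeff_linearInv, monoWt, ← Complex.ofReal_mul, binomWt_eq, e, expo_apply_zero,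
    expo_apply_one]
  congr 1
  ring

/-- Asymptotics of the coefficients along a direction for which the contributing point is a smooth
point. -/
theorem tendsto_termAt_smooth {G : MvPowerSeries (Fin 2) ℂ} {α β r K : ℝ} {v : ℝ × ℝ}
    (h0 : 0 < r) (h1 : r < 1) (hα : α * v.1 = r) (hβ : β * v.2 = 1 - r) (hK : 1 < K)
    (hG : AbsConv G (K • v)) {p q : ℕ} (hp : 0 < p) (hq : 0 < q) (hr : r = p / (p + q))
    (ε δ : ℕ) :
    Tendsto (fun k => termAt (G * linearInv α β) v (expo (k * p + ε) (k * q + δ)) /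
      (binomWt r (k * p + ε) (k * q + δ) : ℝ)) atTop (𝓝 (∑' n, termAt G v n)) := by
  have hp' : (0 : ℝ) < p := Nat.cast_pos.mpr hp
  have hq' : (0 : ℝ) < q := Nat.cast_pos.mpr hq
  have hr1 : 0 < 1 - r := by linarith
  have hrp : r * (p + q) = p := by rw [hr]; field_simp
  have hdir : TendstoDir r (fun k => k * p + ε) (fun k => k * q + δ) :=
    hr ▸ TendstoDir.affine hp hq ε δ
  -- At the unshifted point `(k * p, k * q)` the mean is an integer and the mode bound applies;
  -- moving by `(ε, δ)` costs at most a factor `2`, by slow variation.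
  have hlow : ∀ᶠ k : ℕ in atTop, (1 / 2 : ℝ) ≤
      ((k * p + ε : ℕ) + (k * q + δ : ℕ) + 1) * binomWt r (k * p + ε) (k * q + δ) := by
    have h2 := hdir.binomWt_sub h0 h1 ε δ
    filter_upwards [h2.eventually (gt_mem_nhds (show (1 : ℝ) < 2 by norm_num))] with k hk
    simp only [Nat.add_sub_cancel] at hk
    have hpos := binomWt_pos h0 h1 (k * p + ε) (k * q + δ)
    rw [div_lt_iff₀ hpos] at hk
    have h3 := one_le_mul_binomWt (r := r) (x := k * p) (y := k * q)
      (by push_cast; linear_combination (-(k : ℝ)) * hrp)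
    push_cast at h3 ⊢
    have h4 : (0 : ℝ) ≤ ε := Nat.cast_nonneg ε
    have h5 : (0 : ℝ) ≤ δ := Nat.cast_nonneg δ
    have h6 : (0 : ℝ) ≤ k * p := by positivity
    have h7 : (0 : ℝ) ≤ k * q := by positivity
    nlinarith
  -- This `A` compensates the offsets from the exact direction: `r * (ε / r) = ε` and `(1 - r) * (δ
  -- / (1 - r)) = δ`.
  obtain ⟨C, hC, hbound⟩ := exists_binomWt_sub_le (A := ε / r + δ / (1 - r)) h0 h1 hK
    (by norm_num) hdir.add
    (fun k => by
      have e1 : r * (ε / r) = ε := by field_simp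
      have e2 : 0 ≤ r * (δ / (1 - r)) := by positivity
      have e3 : 0 ≤ r * ε := by positivity
      have e4 : 0 ≤ r * δ := by positivity
      push_cast
      linear_combination e2 + e3 + e4 - e1 - (k : ℝ) * hrp)
    (fun k => by
      have e1 : (1 - r) * (δ / (1 - r)) = δ := by field_simp
      have e2 : 0 ≤ (1 - r) * (ε / r) := by positivity
      have e3 : 0 ≤ (1 - r) * ε := by positivity
      have e4 : 0 ≤ (1 - r) * δ := by positivity
      push_cast
      linear_combination e2 + e3 + e4 - e1 + (k : ℝ) * hrp)
    hlow
  have h2 := tendsto_termAt_mul_div (U := linearInv α β) (u := binomWt r) (by linarith) hG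
    (fun x y => by rw [termAt_linearInv α β v (by linarith), hα]) hdir.left hdir.right
    (fun k => binomWt_pos h0 h1 _ _)
    (by
      filter_upwards [hbound] with k hk α hα β hβ
      rw [abs_of_pos (binomWt_pos h0 h1 _ _)]
      exact hk α hα β hβ)
    (hdir.binomWt_sub h0 h1)
  rw [Complex.ofReal_one, mul_one] at h2
  exact h2

/-- Partial fractions: the first factor on the left is the difference of the two linear factors. -/
theorem linearFactor_mul_linearInv_mul (α β γ δ : ℝ) :
    (MvPowerSeries.C ((γ - α : ℝ) : ℂ) * MvPowerSeries.X 0 +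
        MvPowerSeries.C ((δ - β : ℝ) : ℂ) * MvPowerSeries.X 1) *
        (linearInv α β * linearInv γ δ) = linearInv γ δ - linearInv α β := by
  have h1 := linearFactor_mul_linearInv α β
  have h2 := linearFactor_mul_linearInv γ δ
  rw [coe_linearFactor] at h1 h2
  rw [Complex.ofReal_sub, Complex.ofReal_sub, map_sub, map_sub]
  linear_combination linearInv γ δ * h1 - linearInv α β * h2

/-- At the common point of the two lines the difference of the linear factors vanishes, so its two
monomials have opposite values. After normalisation the partial fraction identity becomes the
recurrence solved by `crossWt`. -/
theorem termAt_linearInv_mul {α β γ δ : ℝ} {v : ℝ × ℝ} (h1 : α * v.1 + β * v.2 = 1)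
    (h2 : γ * v.1 + δ * v.2 = 1) (hne : α * v.1 ≠ γ * v.1) (x y : ℕ) :
    termAt (linearInv α β * linearInv γ δ) v (expo x y) =
      (crossWt (α * v.1) (γ * v.1) x y : ℝ) := by
  have hrel := linearFactor_mul_linearInv_mul α β γ δ
  have e : (δ - β) * v.2 = -((γ - α) * v.1) := by linear_combination h2 - h1
  have e' : ((δ - β : ℝ) : ℂ) * v.2 = -(((γ - α : ℝ) : ℂ) * v.1) := by exact_mod_cast e
  refine eq_crossWt (u := fun x y => termAt (linearInv α β * linearInv γ δ) v (expo x y)) hne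
    (fun y => ?_) (fun x y => ?_) x y
  · rw [← termAt_linearInv α β v h1, ← termAt_linearInv γ δ v h2]
    have h := congrArg (MvPowerSeries.coeff (expo 0 (y + 1))) hrel
    rw [add_mul, mul_assoc, mul_assoc, map_add, map_sub, MvPowerSeries.coeff_C_mul,
      MvPowerSeries.coeff_C_mul, coeff_expo_zero_X_zero_mul, coeff_expo_succ_X_one_mul] at h
    simp only [termAt, monoWt, expo_apply_zero, expo_apply_one]
    push_cast at h e' ⊢
    linear_combination (-(v.2 : ℂ) ^ (y + 1)) * h + MvPowerSeries.coeff (expo 0 y)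
      (linearInv α β * linearInv γ δ) * (v.2 : ℂ) ^ y * e'
  · rw [← termAt_linearInv α β v h1, ← termAt_linearInv γ δ v h2]
    have h := congrArg (MvPowerSeries.coeff (expo (x + 1) (y + 1))) hrel
    rw [add_mul, mul_assoc, mul_assoc, map_add, map_sub, MvPowerSeries.coeff_C_mul,
      MvPowerSeries.coeff_C_mul, coeff_expo_succ_X_zero_mul, coeff_expo_succ_X_one_mul] at h
    simp only [termAt, monoWt, expo_apply_zero, expo_apply_one]
    push_cast at h e' ⊢
    linear_combination (-(v.1 : ℂ) ^ (x + 1) * (v.2 : ℂ) ^ (y + 1)) * h +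
      MvPowerSeries.coeff (expo (x + 1) y)
      (linearInv α β * linearInv γ δ) * (v.1 : ℂ) ^ (x + 1) * (v.2 : ℂ) ^ y * e'

/-- The weights `crossWt` are bounded, so convergence of `G` at `v` itself suffices and no dilation
is needed. -/
theorem tendsto_termAt_cross {G : MvPowerSeries (Fin 2) ℂ} {α β γ δ r : ℝ} {v : ℝ × ℝ}
    (h1 : α * v.1 + β * v.2 = 1) (h2 : γ * v.1 + δ * v.2 = 1) (hα : 0 ≤ α * v.1)
    (hαr : α * v.1 < r) (hγr : r < γ * v.1) (hγ : γ * v.1 ≤ 1)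
    (hG : AbsConv G v) {x y : ℕ → ℕ} (hdir : TendstoDir r x y) :
    Tendsto (fun k => termAt (G * (linearInv α β * linearInv γ δ)) v (expo (x k) (y k))) atTop
      (𝓝 ((∑' n, termAt G v n) * (1 / (γ * v.1 - α * v.1) : ℝ))) := by
  have hpos : 0 < γ * v.1 - α * v.1 := by linarith
  have h := tendsto_termAt_mul_div (U := linearInv α β * linearInv γ δ)
    (u := crossWt (α * v.1) (γ * v.1)) (s := fun _ => 1) (C := 1 / |γ * v.1 - α * v.1|)
    zero_le_one (by rwa [one_smul])
    (termAt_linearInv_mul h1 h2 (by linarith)) hdir.left hdir.right (fun _ => one_pos)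
    (Eventually.of_forall fun k i _ j _ => by
      rw [one_pow, mul_one, mul_one]
      exact abs_crossWt_le hα (by linarith) (by linarith) hγ _ _)
    (fun i j => by
      simp only [div_one]
      exact hdir.crossWt_sub hα hαr hγr hγ i j)
  simpa only [Complex.ofReal_one, div_one] using h

/-! ### From normalised limits to the Horn vector. -/

/-- Neighbouring normalised coefficients have the same nonzero limit over the same scale `σ`, so
their quotient tends to `1`; undoing the normalisation leaves `1 / v.1` and `1 / v.2`. -/
theorem hornVector_of_tendsto {P Q : MvPolynomial (Fin 2) ℂ} {v : ℝ × ℝ} (h1 : 0 < v.1)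
    (h2 : 0 < v.2) {p q : ℕ} {σ : ℕ → ℂ} (hσ : ∀ k, σ k ≠ 0) {L : ℂ} (hL : L ≠ 0)
    (h : ∀ ε δ, Tendsto
      (fun k => termAt (expansion P Q) v (expo (k * p + ε) (k * q + δ)) / σ k) atTop (𝓝 L)) :
    (∀ᶠ k : ℕ in atTop, taylorCoeff P Q (k * p) (k * q) ≠ 0) ∧
      Tendsto (fun k : ℕ => hornVector (taylorCoeff P Q) (k * p) (k * q)) atTop
        (𝓝 (1 / (v.1 : ℂ), 1 / (v.2 : ℂ))) := by
  have hv1 : (v.1 : ℂ) ≠ 0 := Complex.ofReal_ne_zero.mpr h1.ne'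
  have hv2 : (v.2 : ℂ) ≠ 0 := Complex.ofReal_ne_zero.mpr h2.ne'
  have hterm : ∀ x y, termAt (expansion P Q) v (expo x y) =
      taylorCoeff P Q x y * ((v.1 : ℂ) ^ x * (v.2 : ℂ) ^ y) := by
    intro x y
    rw [termAt, monoWt, expo_apply_zero, expo_apply_one]
    push_cast
    rfl
  simp only [hterm] at h
  have hne : ∀ᶠ k : ℕ in atTop, taylorCoeff P Q (k * p) (k * q) ≠ 0 := by
    filter_upwards [(h 0 0).eventually_ne hL] with k hk h0
    simp only [Nat.add_zero] at hk
    exact hk (by rw [h0, zero_mul, zero_div])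
  refine ⟨hne, ?_⟩
  have hz := ((h 1 0).div (h 0 0) hL).mul_const (1 / (v.1 : ℂ))
  have hw := ((h 0 1).div (h 0 0) hL).mul_const (1 / (v.2 : ℂ))
  rw [div_self hL, one_mul] at hz hw
  refine (hz.congr' ?_).prodMk_nhds (hw.congr' ?_)
  · filter_upwards [hne] with k hk
    have := hσ k
    simp only [Pi.div_apply, Nat.add_zero, pow_succ]
    field_simp
  · filter_upwards [hne] with k hk
    have := hσ k
    simp only [Pi.div_apply, Nat.add_zero, pow_succ]
    field_simp

section cofactor

variable {m : ℕ} (a b : Fin m → ℝ) (P : MvPolynomial (Fin 2) ℂ) (S : Finset (Fin m))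

/-- The power series of `P / ∏ Qᵢ`, where `i` runs through `S`. -/
noncomputable def partialExpansion : MvPowerSeries (Fin 2) ℂ :=
  (P : MvPowerSeries (Fin 2) ℂ) * ∏ i ∈ S, linearInv (a i) (b i)

theorem partialExpansion_mul :
    partialExpansion a b P S *
      ((∏ i ∈ S, linearFactor (a i) (b i) : MvPolynomial (Fin 2) ℂ) :
        MvPowerSeries (Fin 2) ℂ) = P := by
  have h : ((∏ i ∈ S, linearFactor (a i) (b i) : MvPolynomial (Fin 2) ℂ) :
      MvPowerSeries (Fin 2) ℂ) = ∏ i ∈ S, (linearFactor (a i) (b i) : MvPowerSeries (Fin 2) ℂ) :=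
    map_prod MvPolynomial.coeToMvPowerSeries.ringHom _ _
  rw [partialExpansion, mul_assoc, h, ← Finset.prod_mul_distrib,
    Finset.prod_eq_one fun i _ => by rw [mul_comm, linearFactor_mul_linearInv], mul_one]

theorem partialExpansion_univ :
    partialExpansion a b P Finset.univ = expansion P (denominator a b) := by
  have h1 := partialExpansion_mul a b P Finset.univ
  have h2 := expansion_mul_denominator a b P
  rw [← denominator] at h1
  refine mul_right_cancel₀ (fun h0 => ?_) (h1.trans h2.symm)
  have h3 := partialExpansion_mul a b 1 Finset.univ
  rw [← denominator, h0, mul_zero, MvPolynomial.coe_one] at h3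
  exact zero_ne_one h3

theorem expansion_eq_mul_single (i : Fin m) :
    expansion P (denominator a b) =
      partialExpansion a b P (Finset.univ.erase i) * linearInv (a i) (b i) := by
  rw [← partialExpansion_univ, partialExpansion, partialExpansion, mul_assoc,
    Finset.prod_erase_mul _ _ (Finset.mem_univ i)]

theorem expansion_eq_mul_pair {i j : Fin m} (hij : i ≠ j) :
    expansion P (denominator a b) =
      partialExpansion a b P ((Finset.univ.erase i).erase j) *
        (linearInv (a i) (b i) * linearInv (a j) (b j)) := by
  rw [expansion_eq_mul_single a b P i, partialExpansion, partialExpansion,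
    ← Finset.prod_erase_mul (Finset.univ.erase i) (fun l => linearInv (a l) (b l))
      (Finset.mem_erase.mpr ⟨hij.symm, Finset.mem_univ j⟩)]
  ring

variable {a b P S}

theorem absConv_partialExpansion (ha : ∀ i, 0 < a i) (hb : ∀ i, 0 < b i) {v : ℝ × ℝ}
    (h1 : 0 < v.1) (h2 : 0 < v.2) (h : ∀ l ∈ S, 0 < 1 - a l * v.1 - b l * v.2) :
    AbsConv (partialExpansion a b P S) v := by
  refine (absConv_coe P v).mul (AbsConv.prod S _ (fun l hl => ?_) ?_)
  · have := h l hl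
    exact absConv_linearInv (ha l) (hb l) h1 h2 (by linarith)
  · rw [← MvPolynomial.coe_one]
    exact absConv_coe 1 v

/-- The strict inequalities survive a small dilation; the smooth case needs this slack against the
geometric bound on shifted binomial weights. -/
theorem exists_absConv_partialExpansion (ha : ∀ i, 0 < a i) (hb : ∀ i, 0 < b i) {v : ℝ × ℝ}
    (h1 : 0 < v.1) (h2 : 0 < v.2) (h : ∀ l ∈ S, 0 < 1 - a l * v.1 - b l * v.2) :
    ∃ K : ℝ, 1 < K ∧ AbsConv (partialExpansion a b P S) (K • v) := by
  have hev : ∀ᶠ K : ℝ in 𝓝[>] 1, ∀ l ∈ S, 0 < 1 - a l * (K * v.1) - b l * (K * v.2) := by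
    refine (Finset.eventually_all S).mpr fun l hl => nhdsWithin_le_nhds ?_
    have hc : Continuous fun K : ℝ => 1 - a l * (K * v.1) - b l * (K * v.2) := by fun_prop
    have := h l hl
    exact (hc.tendsto 1).eventually (lt_mem_nhds (by simpa using this))
  obtain ⟨K, hK, hK1⟩ := (hev.and self_mem_nhdsWithin).exists
  replace hK1 : 1 < K := hK1
  have hK0 : 0 < K := by linarith
  exact ⟨K, hK1, absConv_partialExpansion ha hb (mul_pos hK0 h1) (mul_pos hK0 h2) hK⟩

/-- The sum times the value of the product of linear factors at `v` is the value of `P` there. -/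
theorem tsum_partialExpansion_ne_zero {v : ℝ × ℝ} (h : AbsConv (partialExpansion a b P S) v)
    (hP : MvPolynomial.eval ![(v.1 : ℂ), (v.2 : ℂ)] P ≠ 0) :
    ∑' n, termAt (partialExpansion a b P S) v n ≠ 0 := by
  intro h0
  apply hP
  rw [← tsum_termAt_coe, ← partialExpansion_mul a b P S, tsum_termAt_mul h (absConv_coe _ v), h0,
    zero_mul]

variable (ha : ∀ i, 0 < a i) (hb : ∀ i, 0 < b i) {p q : ℕ} (hp : 0 < p) (hq : 0 < q)

include ha hb hp hq

theorem hornVector_smooth {i : Fin m} {v : ℝ × ℝ} (hv : v = smoothPoint a b i p q)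
    (hQ : ∀ l, l ≠ i → 0 < 1 - a l * v.1 - b l * v.2)
    (hP : MvPolynomial.eval ![(v.1 : ℂ), (v.2 : ℂ)] P ≠ 0) :
    (∀ᶠ k : ℕ in atTop, taylorCoeff P (denominator a b) (k * p) (k * q) ≠ 0) ∧
      Tendsto (fun k : ℕ => hornVector (taylorCoeff P (denominator a b)) (k * p) (k * q)) atTop
        (𝓝 (1 / (v.1 : ℂ), 1 / (v.2 : ℂ))) := by
  have hp' : (0 : ℝ) < p := Nat.cast_pos.mpr hp
  have hq' : (0 : ℝ) < q := Nat.cast_pos.mpr hq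
  have hai := ha i
  have hbi := hb i
  obtain ⟨r, hr⟩ : ∃ r : ℝ, r = p / (p + q) := ⟨_, rfl⟩
  have h0 : 0 < r := by rw [hr]; positivity
  have h1 : r < 1 := by rw [hr, div_lt_one (by positivity)]; linarith
  have hα : a i * v.1 = r := by rw [hv, smoothPoint, hr]; field_simp
  have hβ : b i * v.2 = 1 - r := by rw [hv, smoothPoint, hr]; field_simp; ring
  have hv1 : 0 < v.1 := pos_of_mul_pos_right (hα ▸ h0) hai.le
  have hv2 : 0 < v.2 := pos_of_mul_pos_right (hβ ▸ sub_pos.mpr h1) hbi.le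
  have hS : ∀ l ∈ Finset.univ.erase i, 0 < 1 - a l * v.1 - b l * v.2 :=
    fun l hl => hQ l (Finset.ne_of_mem_erase hl)
  obtain ⟨K, hK, hG⟩ := exists_absConv_partialExpansion (P := P) ha hb hv1 hv2 hS
  refine hornVector_of_tendsto hv1 hv2
    (σ := fun k => ((binomWt r (k * p) (k * q) : ℝ) : ℂ))
    (fun k => Complex.ofReal_ne_zero.mpr (binomWt_pos h0 h1 _ _).ne')
    (tsum_partialExpansion_ne_zero (absConv_partialExpansion ha hb hv1 hv2 hS) hP)
    fun ε δ => ?_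
  have hlim := tendsto_termAt_smooth h0 h1 hα hβ hK hG hp hq hr ε δ
  have hdir : TendstoDir r (fun k => k * p + ε) (fun k => k * q + δ) :=
    hr ▸ TendstoDir.affine hp hq ε δ
  -- The limit above is relative to the weight at the shifted point; slow variation replaces it by
  -- the weight at `(k * p, k * q)`, common to all `ε`, `δ`.
  have hratio := (Complex.continuous_ofReal.tendsto _).comp
    ((hdir.binomWt_sub h0 h1 ε δ).inv₀ one_ne_zero)
  rw [inv_one, Complex.ofReal_one] at hratio
  have h3 := hlim.mul hratio
  rw [mul_one] at h3
  refine h3.congr fun k => ?_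
  have p1 := Complex.ofReal_ne_zero.mpr (binomWt_pos h0 h1 (k * p + ε) (k * q + δ)).ne'
  simp only [Function.comp, Nat.add_sub_cancel, inv_div, Complex.ofReal_div]
  rw [expansion_eq_mul_single a b P i, div_mul_div_cancel₀ p1]

theorem hornVector_cross {i j : Fin m} (hij : i ≠ j) {v : ℝ × ℝ} (hv1 : 0 < v.1) (hv2 : 0 < v.2)
    (hi : 1 - a i * v.1 - b i * v.2 = 0) (hj : 1 - a j * v.1 - b j * v.2 = 0)
    (hlt : a i * v.1 < p / (p + q)) (hgt : p / (p + q) < a j * v.1)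
    (hQ : ∀ l, l ≠ i → l ≠ j → 0 < 1 - a l * v.1 - b l * v.2)
    (hP : MvPolynomial.eval ![(v.1 : ℂ), (v.2 : ℂ)] P ≠ 0) :
    (∀ᶠ k : ℕ in atTop, taylorCoeff P (denominator a b) (k * p) (k * q) ≠ 0) ∧
      Tendsto (fun k : ℕ => hornVector (taylorCoeff P (denominator a b)) (k * p) (k * q)) atTop
        (𝓝 (1 / (v.1 : ℂ), 1 / (v.2 : ℂ))) := by
  have hS : ∀ l ∈ (Finset.univ.erase i).erase j, 0 < 1 - a l * v.1 - b l * v.2 :=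
    fun l hl => hQ l (Finset.ne_of_mem_erase (Finset.mem_of_mem_erase hl))
      (Finset.ne_of_mem_erase hl)
  have hG := absConv_partialExpansion (P := P) ha hb hv1 hv2 hS
  have hc : ((1 / (a j * v.1 - a i * v.1) : ℝ) : ℂ) ≠ 0 :=
    Complex.ofReal_ne_zero.mpr (one_div_pos.mpr (by linarith)).ne'
  refine hornVector_of_tendsto hv1 hv2 (σ := fun _ => 1) (fun _ => one_ne_zero)
    (mul_ne_zero (tsum_partialExpansion_ne_zero hG hP) hc) fun ε δ => ?_
  have hbj : 0 < b j * v.2 := mul_pos (hb j) hv2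
  have h := tendsto_termAt_cross (β := b i) (δ := b j) (by linarith) (by linarith)
    (mul_pos (ha i) hv1).le hlt hgt
    (by linarith) hG (TendstoDir.affine hp hq ε δ)
  rw [expansion_eq_mul_pair a b P hij]
  simpa only [div_one] using h

end cofactor

/-! ### Geometry of the polygon and maxima of monomials. -/

section geometry

variable {m : ℕ} {a b : Fin m → ℝ}

theorem ofReal_mem_line (i : Fin m) (v : ℝ × ℝ) :
    ((v.1 : ℂ), (v.2 : ℂ)) ∈ line a b i ↔ 1 - a i * v.1 - b i * v.2 = 0 := by
  rw [mem_line]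
  simp only
  norm_cast

/-- If the determinant vanished, translating the common point by `(b i, -a i)` would give a second
one. -/
theorem GeneralPosition.crossDet_ne_zero (h : GeneralPosition a b) (hb : ∀ i, 0 < b i)
    {i j : Fin m} (hij : i ≠ j) : crossDet a b i j ≠ 0 := by
  intro h0
  obtain ⟨v, hv⟩ := h.1 i j hij
  have h1 : v ∈ line a b i ∩ line a b j := hv ▸ Set.mem_singleton v
  rw [Set.mem_inter_iff, mem_line, mem_line] at h1
  have h0' : (a i : ℂ) * b j - a j * b i = 0 := by
    rw [crossDet] at h0
    exact_mod_cast h0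
  have h2 : (v.1 + b i, v.2 - a i) ∈ line a b i ∩ line a b j := by
    rw [Set.mem_inter_iff, mem_line, mem_line]
    exact ⟨by linear_combination h1.1, by linear_combination h1.2 + h0'⟩
  rw [hv, Set.mem_singleton_iff] at h2
  have h3 : v.1 + (b i : ℂ) = v.1 := congrArg Prod.fst h2
  rw [add_eq_left, Complex.ofReal_eq_zero] at h3
  exact (hb i).ne' h3

theorem GeneralPosition.ne_zero_of_cross (h : GeneralPosition a b) {i j l : Fin m} (hij : i ≠ j)
    (hli : l ≠ i) (hlj : l ≠ j) {v : ℝ × ℝ} (hi : 1 - a i * v.1 - b i * v.2 = 0)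
    (hj : 1 - a j * v.1 - b j * v.2 = 0) : 1 - a l * v.1 - b l * v.2 ≠ 0 := by
  intro hl
  have h1 := h.2 i j l hij hlj.symm hli.symm
  have h2 : ((v.1 : ℂ), (v.2 : ℂ)) ∈ line a b i ∩ line a b j ∩ line a b l :=
    ⟨⟨(ofReal_mem_line i v).mpr hi, (ofReal_mem_line j v).mpr hj⟩, (ofReal_mem_line l v).mpr hl⟩
  rw [h1] at h2
  exact h2

theorem polygon_nonempty (a b : Fin m → ℝ) : (polygon a b).Nonempty := by
  have hev : ∀ᶠ ε : ℝ in 𝓝[>] 0, ∀ l, 0 < 1 - a l * ε - b l * ε := by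
    refine eventually_all.mpr fun l => nhdsWithin_le_nhds ?_
    have hc : Continuous fun ε : ℝ => 1 - a l * ε - b l * ε := by fun_prop
    exact (hc.tendsto 0).eventually (lt_mem_nhds (by simp))
  obtain ⟨ε, hε, h0⟩ := (hev.and self_mem_nhdsWithin).exists
  exact ⟨(ε, ε), h0, h0, hε⟩

theorem mem_closure_polygon {v : ℝ × ℝ} :
    v ∈ closure (polygon a b) ↔ 0 ≤ v.1 ∧ 0 ≤ v.2 ∧ ∀ l, 0 ≤ 1 - a l * v.1 - b l * v.2 := by
  constructor
  · have hcl : IsClosed {v : ℝ × ℝ | 0 ≤ v.1 ∧ 0 ≤ v.2 ∧ ∀ l, 0 ≤ 1 - a l * v.1 - b l * v.2} := by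
      simp only [Set.ofPred_and, Set.ofPred_forall]
      refine (isClosed_le continuous_const continuous_fst).inter
        ((isClosed_le continuous_const continuous_snd).inter
          (isClosed_iInter fun l => isClosed_le continuous_const (by fun_prop)))
    exact fun h => hcl.closure_subset_iff.mpr
      (fun u hu => ⟨hu.1.le, hu.2.1.le, fun l => (hu.2.2 l).le⟩) h
  · rintro ⟨h1, h2, h3⟩
    obtain ⟨c, hc1, hc2, hc3⟩ := polygon_nonempty a b
    -- The segment from `v` to an interior point `c` lies in the open polygon, except possibly at
    -- `v`.
    have hcont : Continuous fun t : ℝ => ((1 - t) * v.1 + t * c.1, (1 - t) * v.2 + t * c.2) := by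
      fun_prop
    have hlim := (hcont.tendsto 0).mono_left (nhdsWithin_le_nhds (s := Set.Ioi 0))
    simp only [sub_zero, one_mul, zero_mul, add_zero] at hlim
    refine mem_closure_of_tendsto hlim ?_
    filter_upwards [self_mem_nhdsWithin, nhdsWithin_le_nhds (gt_mem_nhds one_pos)] with t ht0 ht1
    replace ht0 : 0 < t := ht0
    have ht2 : 0 ≤ 1 - t := by linarith
    refine ⟨?_, ?_, fun l => ?_⟩
    · exact add_pos_of_nonneg_of_pos (mul_nonneg ht2 h1) (mul_pos ht0 hc1)
    · exact add_pos_of_nonneg_of_pos (mul_nonneg ht2 h2) (mul_pos ht0 hc2)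
    · have e1 := mul_nonneg ht2 (h3 l)
      have e2 := mul_pos ht0 (hc3 l)
      simp only
      linarith

theorem isCompact_closure_polygon (hm : 0 < m) (ha : ∀ i, 0 < a i) (hb : ∀ i, 0 < b i) :
    IsCompact (closure (polygon a b)) := by
  refine IsCompact.of_isClosed_subset
    (isCompact_Icc (a := ((0 : ℝ), (0 : ℝ))) (b := (1 / a ⟨0, hm⟩, 1 / b ⟨0, hm⟩)))
    isClosed_closure fun v hv => ?_
  obtain ⟨h1, h2, h3⟩ := mem_closure_polygon.mp hv
  have h4 := h3 ⟨0, hm⟩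
  have e1 := mul_nonneg (ha ⟨0, hm⟩).le h1
  have e2 := mul_nonneg (hb ⟨0, hm⟩).le h2
  refine ⟨⟨h1, h2⟩, ⟨?_, ?_⟩⟩
  · rw [le_div_iff₀ (ha _)]
    linarith
  · rw [le_div_iff₀ (hb _)]
    linarith

/-- A constraint that is tight inside a segment of the polygon is tight at its endpoints; two tight
nonparallel constraints determine the point. -/
theorem mem_vertices_of_cross {i j : Fin m} (hdet : crossDet a b i j ≠ 0) {v : ℝ × ℝ}
    (hv : v ∈ closure (polygon a b)) (hi : 1 - a i * v.1 - b i * v.2 = 0)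
    (hj : 1 - a j * v.1 - b j * v.2 = 0) : v ∈ vertices a b := by
  have hzero : ∀ x ∈ closure (polygon a b), ∀ y ∈ closure (polygon a b), v ∈ openSegment ℝ x y →
      ∀ l, 1 - a l * v.1 - b l * v.2 = 0 → 1 - a l * x.1 - b l * x.2 = 0 := by
    rintro x hx y hy ⟨s, t, hs, ht, hst, rfl⟩ l hl
    have h1 := (mem_closure_polygon.mp hx).2.2 l
    have h2 := (mem_closure_polygon.mp hy).2.2 l
    simp only [Prod.fst_add, Prod.snd_add, Prod.smul_fst, Prod.smul_snd, smul_eq_mul] at hl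
    have h3 : s * (1 - a l * x.1 - b l * x.2) + t * (1 - a l * y.1 - b l * y.2) = 0 := by
      linear_combination hl + hst
    have h4 := mul_nonneg ht.le h2
    have h5 := mul_nonneg hs.le h1
    exact (mul_eq_zero.mp (show s * (1 - a l * x.1 - b l * x.2) = 0 by linarith)).resolve_left
      hs.ne'
  rw [vertices, mem_extremePoints_iff_left]
  refine ⟨hv, fun x hx y hy hseg => ?_⟩
  rw [(crossPoint_iff a b i j hdet x).mpr
      ⟨hzero x hx y hy hseg i hi, hzero x hx y hy hseg j hj⟩,
    (crossPoint_iff a b i j hdet v).mpr ⟨hi, hj⟩]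

/-- The first-order condition at a maximum of `z ^ p * w ^ q` over the closed polygon. -/
theorem MaxAttainedAt.first_order {p q : ℝ} {v : ℝ × ℝ}
    (h : MaxAttainedAt (closure (polygon a b)) p q v) (hv1 : 0 < v.1) (hv2 : 0 < v.2) {x y : ℝ}
    (hxy : ∀ l, 0 < 1 - a l * v.1 - b l * v.2 ∨ a l * v.1 * x + b l * v.2 * y ≤ 0) :
    p * x + q * y ≤ 0 := by
  -- Compare `v` with `(v.1 * (1 + ε * x), v.2 * (1 + ε * y))` for small `ε > 0`: it stays in the
  -- polygon, and the logarithm of the monomial has derivative `p * x + q * y` at `ε = 0`.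
  by_contra! hcon
  have hx : ∀ᶠ ε : ℝ in 𝓝[>] 0, 0 < 1 + ε * x := by
    have hc : Continuous fun ε : ℝ => 1 + ε * x := by fun_prop
    exact nhdsWithin_le_nhds ((hc.tendsto 0).eventually (lt_mem_nhds (by simp)))
  have hy : ∀ᶠ ε : ℝ in 𝓝[>] 0, 0 < 1 + ε * y := by
    have hc : Continuous fun ε : ℝ => 1 + ε * y := by fun_prop
    exact nhdsWithin_le_nhds ((hc.tendsto 0).eventually (lt_mem_nhds (by simp)))
  have hQ : ∀ᶠ ε : ℝ in 𝓝[>] 0, ∀ l,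
      0 ≤ 1 - a l * (v.1 * (1 + ε * x)) - b l * (v.2 * (1 + ε * y)) := by
    refine eventually_all.mpr fun l => ?_
    rcases hxy l with hl | hl
    · have hc : Continuous fun ε : ℝ =>
          1 - a l * (v.1 * (1 + ε * x)) - b l * (v.2 * (1 + ε * y)) := by fun_prop
      filter_upwards [nhdsWithin_le_nhds
        ((hc.tendsto 0).eventually (lt_mem_nhds (a := 0)
          (by simpa only [zero_mul, add_zero, mul_one] using hl)))] with ε hε using hε.le
    · filter_upwards [self_mem_nhdsWithin] with ε hε
      have h1 := (mem_closure_polygon.mp h.1).2.2 l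
      have h2 := mul_nonneg (le_of_lt (show (0 : ℝ) < ε from hε)) (neg_nonneg.mpr hl)
      linarith
  have hder : ∀ᶠ ε : ℝ in 𝓝[>] 0,
      0 < Real.log (1 + ε * x) * p + Real.log (1 + ε * y) * q := by
    have hd : ∀ c : ℝ, HasDerivAt (fun ε : ℝ => Real.log (1 + ε * c)) c 0 := by
      intro c
      have h1 : HasDerivAt (fun ε : ℝ => 1 + ε * c) c 0 := by
        simpa using ((hasDerivAt_id (0 : ℝ)).mul_const c).const_add 1
      simpa using h1.log (by simp)
    have h2 := ((hd x).mul_const p).add ((hd y).mul_const q)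
    have h3 := (hasDerivAt_iff_tendsto_slope.mp h2).mono_left
      (nhdsWithin_mono (0 : ℝ) (show Set.Ioi (0 : ℝ) ⊆ {0}ᶜ from fun t ht => ne_of_gt ht))
    filter_upwards [h3.eventually (lt_mem_nhds (show 0 < x * p + y * q by linarith)),
      self_mem_nhdsWithin] with ε hε hε0
    replace hε0 : 0 < ε := hε0
    rw [slope_def_field] at hε
    have h4 := (div_pos_iff_of_pos_right (by linarith)).mp hε
    simpa using h4
  obtain ⟨ε, ⟨⟨h1, h2⟩, h3⟩, h4⟩ := (((hx.and hy).and hQ).and hder).exists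
  have h5 := h.2 (v.1 * (1 + ε * x), v.2 * (1 + ε * y))
    (mem_closure_polygon.mpr ⟨(mul_pos hv1 h1).le, (mul_pos hv2 h2).le, h3⟩)
  simp only at h5
  rw [Real.mul_rpow hv1.le h1.le, Real.mul_rpow hv2.le h2.le] at h5
  have h6 : 1 < (1 + ε * x) ^ p * (1 + ε * y) ^ q := by
    rw [Real.rpow_def_of_pos h1, Real.rpow_def_of_pos h2, ← Real.exp_add]
    exact Real.one_lt_exp_iff.mpr h4
  have h7 : 0 < v.1 ^ p * v.2 ^ q :=
    mul_pos (Real.rpow_pos_of_pos hv1 p) (Real.rpow_pos_of_pos hv2 q)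
  nlinarith

/-- At a maximum lying on the lines `i` and `j` only, the direction is between those of the
normals. -/
theorem MaxAttainedAt.between {p q : ℝ} {v : ℝ × ℝ}
    (h : MaxAttainedAt (closure (polygon a b)) p q v) (hp : 0 < p) (hq : 0 < q)
    (hv1 : 0 < v.1) (hv2 : 0 < v.2) {i j : Fin m} (hi : 1 - a i * v.1 - b i * v.2 = 0)
    (hj : 1 - a j * v.1 - b j * v.2 = 0)
    (hQ : ∀ l, l ≠ i → l ≠ j → 0 < 1 - a l * v.1 - b l * v.2) :
    min (a i * v.1) (a j * v.1) ≤ p / (p + q) ∧ p / (p + q) ≤ max (a i * v.1) (a j * v.1) := by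
  have hpq : 0 < p + q := by linarith
  constructor
  · set t := min (a i * v.1) (a j * v.1)
    have h1 : t ≤ a i * v.1 := min_le_left _ _
    have h2 : t ≤ a j * v.1 := min_le_right _ _
    -- On a line through `v` this test direction gives `t - a l * v.1`, nonpositive by the choice of
    -- `t` as a minimum.
    have h3 := h.first_order hv1 hv2 (x := -(1 - t)) (y := t) fun l => by
      by_cases hli : l = i
      · subst hli
        exact Or.inr (by linear_combination h1 - t * hi)
      by_cases hlj : l = j
      · subst hlj
        exact Or.inr (by linear_combination h2 - t * hj)
      exact Or.inl (hQ l hli hlj)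
    rw [le_div_iff₀ hpq]
    linarith
  · set t := max (a i * v.1) (a j * v.1)
    have h1 : a i * v.1 ≤ t := le_max_left _ _
    have h2 : a j * v.1 ≤ t := le_max_right _ _
    have h3 := h.first_order hv1 hv2 (x := 1 - t) (y := -t) fun l => by
      by_cases hli : l = i
      · subst hli
        exact Or.inr (by linear_combination h1 + t * hi)
      by_cases hlj : l = j
      · subst hlj
        exact Or.inr (by linear_combination h2 + t * hj)
      exact Or.inl (hQ l hli hlj)
    rw [div_le_iff₀ hpq]
    linarith

/-- A sufficient condition for a point of the lines `i` and `j` to maximise `z ^ p * w ^ q`. -/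
theorem rpow_mul_rpow_le {p q θ : ℝ} (hp : 0 < p) (hq : 0 < q) (h0 : 0 ≤ θ) (h1 : θ ≤ 1)
    {v u : ℝ × ℝ} (hv1 : 0 < v.1) (hv2 : 0 < v.2) {i j : Fin m}
    (hi : 1 - a i * v.1 - b i * v.2 = 0) (hj : 1 - a j * v.1 - b j * v.2 = 0)
    (hr : p / (p + q) = (1 - θ) * (a i * v.1) + θ * (a j * v.1)) (hu1 : 0 ≤ u.1) (hu2 : 0 ≤ u.2)
    (hui : 0 ≤ 1 - a i * u.1 - b i * u.2) (huj : 0 ≤ 1 - a j * u.1 - b j * u.2) :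
    u.1 ^ p * u.2 ^ q ≤ v.1 ^ p * v.2 ^ q := by
  have hpq : 0 < p + q := by linarith
  obtain ⟨r, hr'⟩ : ∃ r, r = p / (p + q) := ⟨_, rfl⟩
  rw [← hr'] at hr
  have hr0 : 0 ≤ r := by rw [hr']; positivity
  have hr1 : 0 ≤ 1 - r := by
    have : 1 - r = q / (p + q) := by rw [hr']; field_simp; ring
    rw [this]
    positivity
  have hd1 : 0 ≤ u.1 / v.1 := div_nonneg hu1 hv1.le
  have hd2 : 0 ≤ u.2 / v.2 := div_nonneg hu2 hv2.le
  -- The convex combination of the two line constraints with weights `1 - θ`, `θ`. It bounds by `1`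
  -- the arithmetic mean to which weighted AM-GM is applied next.
  have hle : r * (u.1 / v.1) + (1 - r) * (u.2 / v.2) ≤ 1 := by
    have e1 : r * (u.1 / v.1) = ((1 - θ) * a i + θ * a j) * u.1 := by
      rw [hr]; field_simp
    have e2 : 1 - r = (1 - θ) * (b i * v.2) + θ * (b j * v.2) := by
      linear_combination (1 - θ) * hi + θ * hj - hr
    have e3 : (1 - r) * (u.2 / v.2) = ((1 - θ) * b i + θ * b j) * u.2 := by
      rw [e2]; field_simp
    rw [e1, e3]
    have e4 := mul_nonneg (sub_nonneg.mpr h1) hui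
    have e5 := mul_nonneg h0 huj
    linarith
  have hgm := (Real.geom_mean_le_arith_mean2_weighted hr0 hr1 hd1 hd2 (by ring)).trans hle
  have hpow := Real.rpow_le_rpow (mul_nonneg (Real.rpow_nonneg hd1 _) (Real.rpow_nonneg hd2 _)) hgm
    hpq.le
  have e1 : r * (p + q) = p := by rw [hr']; field_simp
  have e2 : (1 - r) * (p + q) = q := by linarith
  rw [Real.mul_rpow (Real.rpow_nonneg hd1 _) (Real.rpow_nonneg hd2 _), ← Real.rpow_mul hd1,
    ← Real.rpow_mul hd2, e1, e2, Real.one_rpow, Real.div_rpow hu1 hv1.le, Real.div_rpow hu2 hv2.le,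
    div_mul_div_comm, div_le_one (mul_pos (Real.rpow_pos_of_pos hv1 p)
      (Real.rpow_pos_of_pos hv2 q))] at hpow
  exact hpow

theorem exists_maxAttainedAt (hm : 0 < m) (ha : ∀ i, 0 < a i) (hb : ∀ i, 0 < b i) {p q : ℝ}
    (hp : 0 < p) (hq : 0 < q) : ∃ v, MaxAttainedAt (closure (polygon a b)) p q v := by
  have hc : Continuous fun u : ℝ × ℝ => u.1 ^ p * u.2 ^ q :=
    (continuous_fst.rpow_const fun _ => Or.inr hp.le).mul
      (continuous_snd.rpow_const fun _ => Or.inr hq.le)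
  obtain ⟨v, hv, hmax⟩ := (isCompact_closure_polygon hm ha hb).exists_isMaxOn
    (polygon_nonempty a b).closure hc.continuousOn
  exact ⟨v, hv, fun u hu => hmax hu⟩

/-- The monomial is positive inside the polygon and vanishes on the axes. -/
theorem MaxAttainedAt.pos {p q : ℝ} {v : ℝ × ℝ}
    (h : MaxAttainedAt (closure (polygon a b)) p q v) (hp : 0 < p) (hq : 0 < q) :
    0 < v.1 ∧ 0 < v.2 := by
  obtain ⟨c, hc⟩ := polygon_nonempty a b
  have h1 := h.2 c (subset_closure hc)
  have h2 : 0 < c.1 ^ p * c.2 ^ q :=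
    mul_pos (Real.rpow_pos_of_pos hc.1 p) (Real.rpow_pos_of_pos hc.2.1 q)
  obtain ⟨h3, h4, -⟩ := mem_closure_polygon.mp h.1
  constructor
  · refine lt_of_le_of_ne h3 fun h0 => ?_
    rw [← h0, Real.zero_rpow hp.ne', zero_mul] at h1
    linarith
  · refine lt_of_le_of_ne h4 fun h0 => ?_
    rw [← h0, Real.zero_rpow hq.ne', mul_zero] at h1
    linarith

end geometry

/-! ### Restriction of a polynomial to a line. -/

/-- The restriction of `P` to the line `1 - α z - β w = 0`, parametrised by
`τ ↦ (τ / α, (1 - τ) / β)`. -/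
noncomputable def lineRestriction (α β : ℝ) (P : MvPolynomial (Fin 2) ℂ) : Polynomial ℂ :=
  MvPolynomial.aeval ![Polynomial.C (1 / α : ℂ) * Polynomial.X,
    Polynomial.C (1 / β : ℂ) * (1 - Polynomial.X)] P

theorem eval_lineRestriction (α β : ℝ) (P : MvPolynomial (Fin 2) ℂ) (τ : ℂ) :
    (lineRestriction α β P).eval τ = MvPolynomial.eval ![τ / α, (1 - τ) / β] P := by
  have h : (Polynomial.evalRingHom τ).comp (MvPolynomial.aeval
      ![Polynomial.C (1 / α : ℂ) * Polynomial.X,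
        Polynomial.C (1 / β : ℂ) * (1 - Polynomial.X)] :
          MvPolynomial (Fin 2) ℂ →ₐ[ℂ] Polynomial ℂ).toRingHom =
      MvPolynomial.eval ![τ / α, (1 - τ) / β] := by
    refine MvPolynomial.ringHom_ext (fun c => ?_) (fun i => ?_)
    · simp
    · fin_cases i <;> simp <;> ring
  exact congrArg (fun f => f P) h

/-- Modulo the linear factor, `α z = 1 - β w`, so substituting `α z` for the parameter undoes the
parametrisation: the quotient map factors through the restriction. -/
theorem linearFactor_dvd_of_lineRestriction_eq_zero {α β : ℝ} (hα : 0 < α) (hβ : 0 < β)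
    {P : MvPolynomial (Fin 2) ℂ} (h : lineRestriction α β P = 0) : linearFactor α β ∣ P := by
  have hα' : (α : ℂ) ≠ 0 := Complex.ofReal_ne_zero.mpr hα.ne'
  have hβ' : (β : ℂ) ≠ 0 := Complex.ofReal_ne_zero.mpr hβ.ne'
  rw [← Ideal.mem_span_singleton, ← Ideal.Quotient.eq_zero_iff_mem]
  let I : Ideal (MvPolynomial (Fin 2) ℂ) := Ideal.span {linearFactor α β}
  let π : MvPolynomial (Fin 2) ℂ →ₐ[ℂ] MvPolynomial (Fin 2) ℂ ⧸ I := Ideal.Quotient.mkₐ ℂ I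
  let ρ : MvPolynomial (Fin 2) ℂ →ₐ[ℂ] Polynomial ℂ := MvPolynomial.aeval
    ![Polynomial.C (1 / α : ℂ) * Polynomial.X, Polynomial.C (1 / β : ℂ) * (1 - Polynomial.X)]
  let ι : Polynomial ℂ →ₐ[ℂ] MvPolynomial (Fin 2) ℂ ⧸ I :=
    Polynomial.aeval (π (MvPolynomial.C (α : ℂ) * MvPolynomial.X 0))
  have hrel : π (MvPolynomial.C (α : ℂ) * MvPolynomial.X 0) =
      1 - π (MvPolynomial.C (β : ℂ) * MvPolynomial.X 1) := by
    rw [← map_one π, ← map_sub]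
    refine (Ideal.Quotient.eq.mpr (Ideal.mem_span_singleton.mpr ⟨-1, ?_⟩))
    rw [linearFactor]
    ring
  have hC : ∀ c : ℂ, algebraMap ℂ (MvPolynomial (Fin 2) ℂ ⧸ I) c = π (MvPolynomial.C c) :=
    fun c => (π.commutes c).symm
  have key : ι.comp ρ = π := by
    refine MvPolynomial.algHom_ext fun i => ?_
    fin_cases i
    · simp only [AlgHom.comp_apply, ρ, ι, MvPolynomial.aeval_X, Fin.zero_eta, Matrix.cons_val_zero,
        map_mul, Polynomial.aeval_C, Polynomial.aeval_X, hC]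
      rw [← map_mul, ← map_mul, ← mul_assoc, ← MvPolynomial.C_mul, one_div,
        inv_mul_cancel₀ hα', MvPolynomial.C_1, one_mul]
    · simp only [AlgHom.comp_apply, ρ, ι, MvPolynomial.aeval_X, Fin.mk_one, Matrix.cons_val_one,
        Matrix.cons_val_fin_one, map_mul, map_sub, map_one, Polynomial.aeval_C, Polynomial.aeval_X,
        hC]
      rw [← map_mul π (MvPolynomial.C (α : ℂ)), hrel, sub_sub_cancel, ← map_mul, ← mul_assoc,
        ← MvPolynomial.C_mul, one_div, inv_mul_cancel₀ hβ', MvPolynomial.C_1, one_mul]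
  calc π P = ι (ρ P) := (congrArg (fun f => f P) key).symm
    _ = ι 0 := congrArg ι h
    _ = 0 := map_zero ι

theorem not_isUnit_linearFactor {α : ℝ} (hα : 0 < α) (β : ℝ) : ¬ IsUnit (linearFactor α β) := by
  intro h
  have h1 := h.map (MvPolynomial.eval ![(1 / α : ℂ), 0])
  have hα' : (α : ℂ) ≠ 0 := Complex.ofReal_ne_zero.mpr hα.ne'
  simp [linearFactor, hα'] at h1

/-! ### Exceptional directions and contributing points. -/

section directions

variable {m : ℕ} {a b : Fin m → ℝ} {P : MvPolynomial (Fin 2) ℂ}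

/-- The exceptional values of `p / (p + q)`. -/
def exceptionalRatios (a b : Fin m → ℝ) (P : MvPolynomial (Fin 2) ℂ) : Set ℝ :=
  {0, 1} ∪ (⋃ i, {τ | MvPolynomial.eval ![(τ / a i : ℂ), (1 - τ) / b i] P = 0}) ∪
    ⋃ i, ⋃ j, {τ | i ≠ j ∧ 1 - a j * (τ / a i) - b j * ((1 - τ) / b i) = 0}

/-- A line on which `P` vanished identically would give a common factor with the denominator, so `P`
has finitely many zeros on each. A second line meets a given one at a single parameter. -/
theorem finite_exceptionalRatios (ha : ∀ i, 0 < a i) (hb : ∀ i, 0 < b i)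
    (hgen : GeneralPosition a b) (hred : IsRelPrime P (denominator a b)) :
    (exceptionalRatios a b P).Finite := by
  refine (((Set.finite_singleton 1).insert 0).union (Set.finite_iUnion fun i => ?_)).union
    (Set.finite_iUnion fun i => Set.finite_iUnion fun j => ?_)
  · have hne : lineRestriction (a i) (b i) P ≠ 0 := fun h0 =>
      not_isUnit_linearFactor (ha i) (b i) (hred
        (linearFactor_dvd_of_lineRestriction_eq_zero (ha i) (hb i) h0)
        (Finset.dvd_prod_of_mem _ (Finset.mem_univ i)))
    have hfin := (Polynomial.finite_setOfPred_isRoot hne).preimage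
      (Complex.ofReal_injective.injOn (s := Complex.ofReal ⁻¹' _))
    refine hfin.subset fun τ hτ => ?_
    rw [Set.mem_preimage]
    exact (eval_lineRestriction (a i) (b i) P τ).trans hτ
  · by_cases hij : i = j
    · refine Set.finite_empty.subset fun τ hτ => hτ.1 hij
    · refine (Set.finite_singleton (a i * (b j - b i) / crossDet a b i j)).subset fun τ hτ => ?_
      have hdet := hgen.crossDet_ne_zero hb hij
      have h1 := hτ.2
      have hai := (ha i).ne'
      have hbi := (hb i).ne'
      field_simp at h1
      rw [Set.mem_singleton_iff, eq_div_iff hdet, crossDet]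
      linear_combination h1

theorem forAlmostAllDirections_of_ratio {φ : ℕ → ℕ → Prop} {T : Set ℝ} (hT : T.Finite)
    (h : ∀ p q : ℕ, 0 < p + q → (p : ℝ) / (p + q) ∉ T → φ p q) : ForAlmostAllDirections φ := by
  classical
  -- The extra ray through `(1, 0)` ensures that the origin is excluded even when `T` is empty.
  refine ⟨insert (1, 0) (hT.toFinset.image fun τ => (τ, 1 - τ)), fun p q hpq => ?_⟩
  have hpos : 0 < p + q := by
    by_contra! h0
    obtain ⟨rfl, rfl⟩ : p = 0 ∧ q = 0 := by omega
    exact hpq _ (Finset.mem_insert_self _ _) 0 le_rfl (by simp)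
  refine h p q hpos fun hmem => ?_
  have hpos' : (0 : ℝ) < p + q := by exact_mod_cast hpos
  refine hpq _ (Finset.mem_insert_of_mem (Finset.mem_image_of_mem _
    (hT.mem_toFinset.mpr hmem))) (p + q) hpos'.le ?_
  ext
  · simp only [Prod.smul_fst, smul_eq_mul]
    field_simp
  · simp only [Prod.smul_snd, smul_eq_mul]
    field_simp
    ring

variable (ha : ∀ i, 0 < a i) (hb : ∀ i, 0 < b i)

theorem smoothPoint_eq (i : Fin m) {p q : ℝ} (hpq : 0 < p + q) :
    smoothPoint a b i p q = (p / (p + q) / a i, (1 - p / (p + q)) / b i) := by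
  rw [smoothPoint]
  congr 2
  field_simp
  ring

include ha hb in
theorem smoothPoint_mem_line (i : Fin m) {p q : ℝ} (hpq : 0 < p + q) :
    1 - a i * (smoothPoint a b i p q).1 - b i * (smoothPoint a b i p q).2 = 0 :=
  ((smoothPoint_iff a b i (ha i) (hb i) hpq _).mp rfl).1

include ha hb in
theorem eq_smoothPoint {i : Fin m} {p q : ℝ} {v : ℝ × ℝ}
    (hpq : 0 < p + q) (hv : 1 - a i * v.1 - b i * v.2 = 0) (hr : p / (p + q) = a i * v.1) :
    v = smoothPoint a b i p q := by
  have hai := (ha i).ne'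
  have hbi := (hb i).ne'
  rw [smoothPoint_eq i hpq, hr]
  ext
  · simp only
    field_simp
  · simp only
    field_simp
    linarith

-- The strict inequalities persist for nearby directions, and AM-GM with the single line `i` then
-- gives both maxima.
include ha hb in
theorem mem_interior_coneK {i : Fin m} {p q : ℝ} (hp : 0 < p) (hq : 0 < q)
    (hQ : ∀ l, l ≠ i →
      0 < 1 - a l * (smoothPoint a b i p q).1 - b l * (smoothPoint a b i p q).2) :
    (p, q) ∈ interior (coneK a b i) := by
  rw [mem_interior_iff_mem_nhds]
  have hcont : ContinuousAt (fun d : ℝ × ℝ => smoothPoint a b i d.1 d.2) (p, q) := by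
    have hpq : (p + q : ℝ) ≠ 0 := by linarith
    have h1 : ContinuousAt (fun d : ℝ × ℝ => d.1 + d.2) (p, q) := by fun_prop
    exact ((continuousAt_fst.div h1 hpq).div_const _).prodMk
      ((continuousAt_snd.div h1 hpq).div_const _)
  have hev : ∀ᶠ d : ℝ × ℝ in 𝓝 (p, q), ∀ l, l ≠ i →
      0 < 1 - a l * (smoothPoint a b i d.1 d.2).1 - b l * (smoothPoint a b i d.1 d.2).2 := by
    refine eventually_all.mpr fun l => ?_
    by_cases hl : l = i
    · exact Eventually.of_forall fun d h => absurd hl h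
    have h2 : Continuous fun u : ℝ × ℝ => 1 - a l * u.1 - b l * u.2 := by fun_prop
    filter_upwards [(h2.continuousAt.comp hcont).eventually (lt_mem_nhds (hQ l hl))] with d hd _
      using hd
  filter_upwards [hev, continuousAt_fst.eventually (lt_mem_nhds hp),
    continuousAt_snd.eventually (lt_mem_nhds hq)] with d hd hd1 hd2
  have hpq : 0 < d.1 + d.2 := by linarith
  have hv1 : 0 < (smoothPoint a b i d.1 d.2).1 := div_pos (div_pos hd1 hpq) (ha i)
  have hv2 : 0 < (smoothPoint a b i d.1 d.2).2 := div_pos (div_pos hd2 hpq) (hb i)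
  have hi := smoothPoint_mem_line ha hb i hpq
  have hai := (ha i).ne'
  have hr : d.1 / (d.1 + d.2) = (1 - 0) * (a i * (smoothPoint a b i d.1 d.2).1) +
      0 * (a i * (smoothPoint a b i d.1 d.2).1) := by
    rw [smoothPoint]
    field_simp
    ring
  refine ⟨hd1.le, hd2.le, ⟨mem_closure_polygon.mpr ⟨hv1.le, hv2.le, fun l => ?_⟩, fun u hu => ?_⟩,
    ⟨hv1.le, hv2.le, (ofReal_mem_line i _).mpr hi⟩, fun u hu => ?_⟩
  · by_cases hl : l = i
    · rw [hl, hi]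
    · exact (hd l hl).le
  · obtain ⟨hu1, hu2, hu3⟩ := mem_closure_polygon.mp hu
    exact rpow_mul_rpow_le hd1 hd2 le_rfl zero_le_one hv1 hv2 hi hi hr hu1 hu2 (hu3 i) (hu3 i)
  · obtain ⟨hu1, hu2, hu3⟩ := hu
    have hu4 := ((ofReal_mem_line i u).mp hu3).ge
    exact rpow_mul_rpow_le hd1 hd2 le_rfl zero_le_one hv1 hv2 hi hi hr hu1 hu2 hu4 hu4

theorem mem_interior_coneΩ {i j : Fin m} {p q : ℝ} (hp : 0 < p) (hq : 0 < q) {v : ℝ × ℝ}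
    (hv : v = crossPoint a b i j) (hmem : v ∈ closure (polygon a b)) (hv1 : 0 < v.1)
    (hv2 : 0 < v.2) (hi : 1 - a i * v.1 - b i * v.2 = 0) (hj : 1 - a j * v.1 - b j * v.2 = 0)
    (hlt : a i * v.1 < p / (p + q)) (hgt : p / (p + q) < a j * v.1) :
    (p, q) ∈ interior (coneΩ a b i j) := by
  rw [mem_interior_iff_mem_nhds]
  have hcont : ContinuousAt (fun d : ℝ × ℝ => d.1 / (d.1 + d.2)) (p, q) := by
    have hpq : (p + q : ℝ) ≠ 0 := by linarith
    have h1 : ContinuousAt (fun d : ℝ × ℝ => d.1 + d.2) (p, q) := by fun_prop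
    exact continuousAt_fst.div h1 hpq
  filter_upwards [hcont.eventually (lt_mem_nhds hlt), hcont.eventually (gt_mem_nhds hgt),
    continuousAt_fst.eventually (lt_mem_nhds hp),
    continuousAt_snd.eventually (lt_mem_nhds hq)] with d h1 h2 hd1 hd2
  refine ⟨hd1.le, hd2.le, ?_⟩
  rw [← hv]
  refine ⟨hmem, fun u hu => ?_⟩
  obtain ⟨hu1, hu2, hu3⟩ := mem_closure_polygon.mp hu
  have hpos : 0 < a j * v.1 - a i * v.1 := by linarith
  refine rpow_mul_rpow_le hd1 hd2
    -- The solution of `r = (1 - θ) * (a i * v.1) + θ * (a j * v.1)` with `r = d.1 / (d.1 + d.2)`.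
    (θ := (d.1 / (d.1 + d.2) - a i * v.1) / (a j * v.1 - a i * v.1))
    (div_nonneg (by linarith) hpos.le) ((div_le_one hpos).mpr (by linarith)) hv1 hv2 hi hj ?_
    hu1 hu2 (hu3 i) (hu3 j)
  generalize d.1 / (d.1 + d.2) = r
  generalize a j * v.1 = s at hpos ⊢
  generalize a i * v.1 = t at hpos ⊢
  field_simp
  ring

variable {p q : ℕ}

theorem pos_of_notMem_exceptionalRatios (hpq : 0 < p + q)
    (hr : (p : ℝ) / (p + q) ∉ exceptionalRatios a b P) : 0 < p ∧ 0 < q := by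
  constructor
  · refine Nat.pos_of_ne_zero fun h0 => hr (Or.inl (Or.inl (Or.inl ?_)))
    rw [h0, Nat.cast_zero, zero_div]
  · refine Nat.pos_of_ne_zero fun h0 => hr (Or.inl (Or.inl (Or.inr ?_)))
    have hp : (p : ℝ) ≠ 0 := Nat.cast_ne_zero.mpr (by omega)
    rw [h0, Nat.cast_zero, add_zero, div_self hp]
    rfl

theorem smoothPoint_notMem_line (hpq : 0 < p + q)
    (hr : (p : ℝ) / (p + q) ∉ exceptionalRatios a b P) {i j : Fin m} (hij : i ≠ j) :
    1 - a j * (smoothPoint a b i p q).1 - b j * (smoothPoint a b i p q).2 ≠ 0 := by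
  intro h0
  rw [smoothPoint_eq i (by exact_mod_cast hpq)] at h0
  exact hr (Or.inr (Set.mem_iUnion.mpr ⟨i, Set.mem_iUnion.mpr ⟨j, hij, h0⟩⟩))

theorem eval_smoothPoint_ne_zero (hpq : 0 < p + q)
    (hr : (p : ℝ) / (p + q) ∉ exceptionalRatios a b P) (i : Fin m) :
    MvPolynomial.eval ![((smoothPoint a b i p q).1 : ℂ), ((smoothPoint a b i p q).2 : ℂ)] P ≠
      0 := by
  intro h0
  rw [smoothPoint_eq i (by exact_mod_cast hpq)] at h0
  refine hr (Or.inl (Or.inr (Set.mem_iUnion.mpr ⟨i, ?_⟩)))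
  push_cast at h0
  rw [Set.mem_ofPred_eq]
  push_cast
  exact h0

-- Equality would make `v` the smooth point of line `i` while also on line `j`, an excluded
-- direction.
include ha hb in
theorem cross_ratio_ne (hpq : 0 < p + q)
    (hr : (p : ℝ) / (p + q) ∉ exceptionalRatios a b P) {i j : Fin m} (hij : i ≠ j) {v : ℝ × ℝ}
    (hi : 1 - a i * v.1 - b i * v.2 = 0) (hj : 1 - a j * v.1 - b j * v.2 = 0) :
    (p : ℝ) / (p + q) ≠ a i * v.1 := by
  intro h0
  have h1 := eq_smoothPoint ha hb (by exact_mod_cast hpq) hi h0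
  rw [h1] at hj
  exact smoothPoint_notMem_line hpq hr hij hj

include ha hb in
theorem MaxAttainedAt.strict_between {v : ℝ × ℝ}
    (h : MaxAttainedAt (closure (polygon a b)) p q v) (hgen : GeneralPosition a b)
    (hpq : 0 < p + q) (hr : (p : ℝ) / (p + q) ∉ exceptionalRatios a b P) {i j : Fin m}
    (hij : i ≠ j) (hi : 1 - a i * v.1 - b i * v.2 = 0) (hj : 1 - a j * v.1 - b j * v.2 = 0) :
    (∀ l, l ≠ i → l ≠ j → 0 < 1 - a l * v.1 - b l * v.2) ∧
      ((a i * v.1 < p / (p + q) ∧ p / (p + q) < a j * v.1) ∨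
        (a j * v.1 < p / (p + q) ∧ p / (p + q) < a i * v.1)) := by
  obtain ⟨hp, hq⟩ := pos_of_notMem_exceptionalRatios hpq hr
  have hp' : (0 : ℝ) < p := Nat.cast_pos.mpr hp
  have hq' : (0 : ℝ) < q := Nat.cast_pos.mpr hq
  obtain ⟨hv1, hv2⟩ := h.pos hp' hq'
  have hQ : ∀ l, l ≠ i → l ≠ j → 0 < 1 - a l * v.1 - b l * v.2 := fun l hli hlj =>
    lt_of_le_of_ne ((mem_closure_polygon.mp h.1).2.2 l)
      (hgen.ne_zero_of_cross hij hli hlj hi hj).symm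
  refine ⟨hQ, ?_⟩
  have h1 := h.between hp' hq' hv1 hv2 hi hj hQ
  have h2 := cross_ratio_ne ha hb hpq hr hij hi hj
  have h3 := cross_ratio_ne ha hb hpq hr hij.symm hj hi
  rcases le_total (a i * v.1) (a j * v.1) with h4 | h4
  · rw [min_eq_left h4, max_eq_right h4] at h1
    exact Or.inl ⟨lt_of_le_of_ne h1.1 h2.symm, lt_of_le_of_ne h1.2 h3⟩
  · rw [min_eq_right h4, max_eq_left h4] at h1
    exact Or.inr ⟨lt_of_le_of_ne h1.1 h3.symm, lt_of_le_of_ne h1.2 h2⟩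

-- The maximiser itself is the contributing point: a smooth point if it lies on one line, a crossing
-- if on two.
include ha hb in
theorem exists_isContributingPoint (hm : 0 < m) (hgen : GeneralPosition a b) (hpq : 0 < p + q)
    (hr : (p : ℝ) / (p + q) ∉ exceptionalRatios a b P) :
    ∃ v, IsContributingPoint a b p q v := by
  obtain ⟨hp, hq⟩ := pos_of_notMem_exceptionalRatios hpq hr
  have hp' : (0 : ℝ) < p := Nat.cast_pos.mpr hp
  have hq' : (0 : ℝ) < q := Nat.cast_pos.mpr hq
  obtain ⟨v, hv⟩ := exists_maxAttainedAt hm ha hb hp' hq'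
  obtain ⟨hv1, hv2⟩ := hv.pos hp' hq'
  have hnn := (mem_closure_polygon.mp hv.1).2.2
  refine ⟨v, ?_⟩
  obtain ⟨i, hi⟩ : ∃ i, 1 - a i * v.1 - b i * v.2 = 0 := by
    by_contra! hne
    -- With no tight line, moving along `(1, 1)` would increase the monomial.
    have := hv.first_order hv1 hv2 (x := 1) (y := 1)
      fun l => Or.inl (lt_of_le_of_ne (hnn l) (hne l).symm)
    linarith
  by_cases hj : ∃ j, i ≠ j ∧ 1 - a j * v.1 - b j * v.2 = 0
  · obtain ⟨j, hij, hj⟩ := hj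
    right
    rcases (hv.strict_between ha hb hgen hpq hr hij hi hj).2 with h | h
    · have hvc := (crossPoint_iff a b i j (hgen.crossDet_ne_zero hb hij) v).mpr ⟨hi, hj⟩
      exact ⟨i, j, hij, mem_interior_coneΩ hp' hq' hvc hv.1 hv1 hv2 hi hj h.1 h.2, hvc⟩
    · have hvc := (crossPoint_iff a b j i (hgen.crossDet_ne_zero hb hij.symm) v).mpr ⟨hj, hi⟩
      exact ⟨j, i, hij.symm, mem_interior_coneΩ hp' hq' hvc hv.1 hv1 hv2 hj hi h.1 h.2, hvc⟩
  · push Not at hj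
    have hQ : ∀ l, l ≠ i → 0 < 1 - a l * v.1 - b l * v.2 := fun l hl =>
      lt_of_le_of_ne (hnn l) (hj l hl.symm).symm
    have h1 := hv.between hp' hq' hv1 hv2 hi hi fun l hl _ => hQ l hl
    rw [min_self, max_self] at h1
    have hvs := eq_smoothPoint ha hb (by linarith) hi (le_antisymm h1.2 h1.1)
    exact Or.inl ⟨i, mem_interior_coneK ha hb hp' hq' (hvs ▸ hQ), hvs⟩

end directions

end HornVector

/-! ### Assembly. -/

theorem mainTheorem4 (m : ℕ) (hm : 0 < m) (a b : Fin m → ℝ)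
    (ha : ∀ i, 0 < a i) (hb : ∀ i, 0 < b i)
    (hgen : HornVector.GeneralPosition a b)
    (P : MvPolynomial (Fin 2) ℂ)
    (hred : IsRelPrime P (HornVector.denominator a b))
    (hvert : ∀ v ∈ HornVector.vertices a b, v.1 ≠ 0 → v.2 ≠ 0 →
      MvPolynomial.eval ![(v.1 : ℂ), (v.2 : ℂ)] P ≠ 0) :
    HornVector.ForAlmostAllDirections fun p q =>
      (∃ v, HornVector.IsContributingPoint a b p q v) ∧
      ∀ v, HornVector.IsContributingPoint a b p q v →
        0 < v.1 ∧ 0 < v.2 ∧ ((v.1 : ℂ), (v.2 : ℂ)) ∈ HornVector.singularSet a b ∧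
        (∀ᶠ k : ℕ in atTop,
          HornVector.taylorCoeff P (HornVector.denominator a b) (k * p) (k * q) ≠ 0) ∧
        Tendsto
          (fun k : ℕ => HornVector.hornVector
            (HornVector.taylorCoeff P (HornVector.denominator a b)) (k * p) (k * q))
          atTop (𝓝 (1 / (v.1 : ℂ), 1 / (v.2 : ℂ))) := by
  refine HornVector.forAlmostAllDirections_of_ratio
    (HornVector.finite_exceptionalRatios ha hb hgen hred) fun p q hpq hr => ?_
  refine ⟨HornVector.exists_isContributingPoint ha hb hm hgen hpq hr, fun v hv => ?_⟩
  obtain ⟨hp, hq⟩ := HornVector.pos_of_notMem_exceptionalRatios hpq hr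
  have hp' : (0 : ℝ) < p := Nat.cast_pos.mpr hp
  have hq' : (0 : ℝ) < q := Nat.cast_pos.mpr hq
  rcases hv with ⟨i, hK, rfl⟩ | ⟨i, j, hij, hΩ, rfl⟩
  · obtain ⟨-, -, hmax, -⟩ := interior_subset hK
    obtain ⟨hv1, hv2⟩ := hmax.pos hp' hq'
    refine ⟨hv1, hv2, (HornVector.mem_singularSet a b _).mpr
      ⟨i, (HornVector.ofReal_mem_line i _).mpr (HornVector.smoothPoint_mem_line ha hb i (by linarith))⟩, ?_⟩
    -- At smooth points `P ≠ 0` comes from discarding directions, at crossings from the vertex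
    -- hypothesis.
    exact HornVector.hornVector_smooth ha hb hp hq rfl
      (fun l hl => lt_of_le_of_ne ((HornVector.mem_closure_polygon.mp hmax.1).2.2 l)
        (HornVector.smoothPoint_notMem_line hpq hr hl.symm).symm)
      (HornVector.eval_smoothPoint_ne_zero hpq hr i)
  · obtain ⟨-, -, hmax⟩ := interior_subset hΩ
    have hdet := hgen.crossDet_ne_zero hb hij
    obtain ⟨hi, hj⟩ := (HornVector.crossPoint_iff a b i j hdet _).mp rfl
    obtain ⟨hv1, hv2⟩ := hmax.pos hp' hq'
    have hP := hvert _ (HornVector.mem_vertices_of_cross hdet hmax.1 hi hj) hv1.ne' hv2.ne'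
    obtain ⟨hQ, hlt⟩ := hmax.strict_between ha hb hgen hpq hr hij hi hj
    refine ⟨hv1, hv2, (HornVector.mem_singularSet a b _).mpr
      ⟨i, (HornVector.ofReal_mem_line i _).mpr hi⟩, ?_⟩
    -- `hornVector_cross` expects the line with the smaller success probability first.
    rcases hlt with h | h
    · exact HornVector.hornVector_cross ha hb hp hq hij hv1 hv2 hi hj h.1 h.2 hQ hP
    · exact HornVector.hornVector_cross ha hb hp hq hij.symm hv1 hv2 hj hi h.1 h.2
        (fun l h1 h2 => hQ l h2 h1) hP
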